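/- Let $P_k=\mathbb F_2[x_1,\dots,x_k]$, each $x_j$ of degree $1$, with its standard module structure over the mod-2 Steenrod algebra $\mathcal A$: the linear operations $Sq^i$ ($i\ge 0$) satisfy $Sq^0x_j=x_j$, $Sq^1x_j=x_j^2$, $Sq^ix_j=0$ for $i>1$, and the Cartan formula $Sq^m(fg)=\sum_{i=0}^m Sq^i(f)Sq^{m-i}(g)$. Let $\mathcal A^+P_k=\sum_{i>0}Sq^i(P_k)$. A set $S$ of homogeneous polynomials of degree $n$ in $P_k$ is a *set of generators of the $\mathcal A$-module $P_k$ in degree $n$* if every homogeneous polynomial of degree $n$ is an $\mathbb F_2$-linear combination of elements of $S$ modulo $\mathcal A^+P_k$; it is *minimal* if no proper subset of $S$ has this property. Let $\mathcal N_k$ be the set of pairs $(i;I)$ with $I=(i_1,\dots,i_r)$, $0\le r<k$, $1\le i<i_1<\dots<i_r\le k$; write $r=\ell(I)$. Let $f_i:P_{k-1}\to P_k$ be the algebra homomorphism with $f_i(x_j)=x_j$ for $j<i$ and $f_i(x_j)=x_{j+1}$ for $i\le j<k$. For a monomial $x$ let $\nu_j(x)$ be the exponent of $x_j$ in $x$,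 and let $\alpha_s(a)$ be the coefficient of $2^s$ in the binary expansion of $a$. For $1\le u\le r$, a monomial $x\in P_{k-1}$ is *$u$-compatible* with $(i;I)$ if (i) $\nu_{i_t-1}(x)=2^r-1$ for $1\le t<u$; (ii) $\nu_{i_u-1}(x)>2^r-1$; (iii) $\alpha_{r-t}(\nu_{i_u-1}(x))=1$ for $1\le t\le u$; (iv) $\alpha_{r-t}(\nu_{i_t-1}(x))=1$ for $u<t\le r$. This holds for at most one $u$. Let $\phi_{(i;I)}:P_{k-1}\to P_k$ be the $\mathbb F_2$-linear map given on monomials as follows: $\phi_{(i;\emptyset)}(x)=f_i(x)$; and, for $r>0$, $$\phi_{(i;I)}(x)=\frac{x_i^{2^r-1}f_i(x)}{x_{i_u}^{2^{r-1}+\dots+2^{r-u}}\prod_{u<t\le r}x_{i_t}^{2^{r-t}}}$$ if $x$ is $u$-compatible with $(i;I)$ for some $u$, and $\phi_{(i;I)}(x)=0$ otherwise. Let $P_k^0$ be the span of the monomials of $P_k$ in which some variable does not occur. For a set $B\subset P_{k-1}$ put $$\Phi(B)=\Big(\bigcup_{1\le i\le k}\phi_{(i;\emptyset)}(B)\Big)\cup\Big(\bigcup_{(i;I)\in\mathcal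 N_k,\ \ell(I)>0}\phi_{(i;I)}(B)\setminus P_k^0\Big).$$ **Proposition.** Let $k-1\ge 3$ and $n=\sum_{1\le i\le k-1}(2^{d_i}-1)$ with integers $d_1>d_2>\dots>d_{k-2}\ge d_{k-1}\ge k-1$. If $B=B_{k-1}(n)$ is a minimal set of generators of the $\mathcal A$-module $P_{k-1}$ in degree $n$, then $\Phi(B)$ is a minimal set of generators of the $\mathcal A$-module $P_k$ in degree $n$. Moreover $\Phi(B)=\bigcup_{(i;I)\in\mathcal N_k}\phi_{(i;I)}(B)$, the sets $\phi_{(i;I)}(B)$ for different $(i;I)\in\mathcal N_k$ are pairwise disjoint, each of them has the same cardinality as $B$, and $|\mathcal N_k|=2^k-1$. -/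

import Mathlib

/-! The hit problem for the polynomial algebra over the mod-2 Steenrod algebra. -/

namespace HitProblem

noncomputable section

/-- The polynomial algebra `P_k = 𝔽₂[x_1, …, x_k]`; the variable `x_j` is `X (j - 1)`, i.e. the
variables are indexed from `0` here. -/
abbrev P (k : ℕ) : Type := MvPolynomial (Fin k) (ZMod 2)

/-- The total Steenrod square `Sq = ∑ Sq^i T^i`, the algebra homomorphism `P_k → P_k[T]` with
`x_j ↦ x_j + x_j² T`. -/
def totalSq (k : ℕ) : P k →ₐ[ZMod 2] Polynomial (P k) :=
  MvPolynomial.aeval fun j : Fin k =>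
    Polynomial.C (MvPolynomial.X j) + Polynomial.C (MvPolynomial.X j ^ 2) * Polynomial.X

/-- The Steenrod square `Sq^i : P_k → P_k`, the coefficient of `T^i` in the total square. -/
def Sq (k i : ℕ) : P k →ₗ[ZMod 2] P k :=
  ((Polynomial.lcoeff (P k) i).restrictScalars (ZMod 2)).comp (totalSq k).toLinearMap

theorem Sq_apply (k i : ℕ) (f : P k) : Sq k i f = (totalSq k f).coeff i := rfl

/-- The defining values: `Sq^0 x_j = x_j`, `Sq^1 x_j = x_j²`, `Sq^i x_j = 0` for `i > 1`. -/
theorem Sq_X (k i : ℕ) (j : Fin k) :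
    Sq k i (MvPolynomial.X j) =
      if i = 0 then MvPolynomial.X j else if i = 1 then MvPolynomial.X j ^ 2 else 0 := by
  rw [Sq_apply, totalSq, MvPolynomial.aeval_X, Polynomial.coeff_add, Polynomial.coeff_C,
    Polynomial.coeff_C_mul, Polynomial.coeff_X]
  rcases i with _ | _ | i <;> simp

/-- `Sq^0 1 = 1` and `Sq^i 1 = 0` for `i > 0`. -/
theorem Sq_one (k i : ℕ) : Sq k i 1 = if i = 0 then 1 else 0 := by
  rw [Sq_apply, map_one, Polynomial.coeff_one]

/-- The Cartan formula. -/
theorem Sq_mul (k m : ℕ) (f g : P k) :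
    Sq k m (f * g) = ∑ i ∈ Finset.range (m + 1), Sq k i f * Sq k (m - i) g := by
  rw [Sq_apply, map_mul, Polynomial.coeff_mul,
    Finset.Nat.sum_antidiagonal_eq_sum_range_succ_mk]
  rfl

/-- `𝒜⁺P_k`, the space of hit polynomials: finite sums `∑_{i > 0} Sq^i(f_i)`. -/
def hit (k : ℕ) : Submodule (ZMod 2) (P k) :=
  ⨆ i : {i : ℕ // 0 < i}, LinearMap.range (Sq k i)

/-- `S` is a set of generators for the `𝒜`-module `P_k` in degree `n`: it consists of homogeneous
polynomials of degree `n`, and every polynomial in `(P_k)_n` is an `𝔽₂`-linear combination of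
elements of `S` modulo hit polynomials, i.e. the classes of the elements of `S` span `(QP_k)_n`. -/
def IsGeneratingSet (k n : ℕ) (S : Set (P k)) : Prop :=
  S ⊆ MvPolynomial.homogeneousSubmodule (Fin k) (ZMod 2) n ∧
    MvPolynomial.homogeneousSubmodule (Fin k) (ZMod 2) n ≤
      Submodule.span (ZMod 2) S ⊔ hit k

/-- `S` is a minimal set of generators for the `𝒜`-module `P_k` in degree `n`: no proper subset of
`S` is a set of generators in degree `n`. -/
def IsMinimalGeneratingSet (k n : ℕ) (S : Set (P k)) : Prop :=
  Minimal (IsGeneratingSet k n) S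

/-- The set `𝒩_k` of pairs `(i; I)` with `I = (i_1 < … < i_r)` and `i < i_1`. The increasing
sequence `I` is given by the set of its entries. -/
@[ext]
structure Idx (k : ℕ) where
  i : Fin k
  I : Finset (Fin k)
  lt : ∀ j ∈ I, i < j

variable {l : ℕ}

/-- The length `r = ℓ(I)`. -/
def Idx.r (p : Idx (l + 1)) : ℕ := p.I.card

/-- The entry `i_t` of `I`, where `t` runs from `0` to `r - 1` instead of from `1` to `r`. -/
def Idx.entry (p : Idx (l + 1)) (t : Fin p.r) : Fin (l + 1) := p.I.orderEmbOfFin rfl t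

theorem Idx.entry_ne_zero (p : Idx (l + 1)) (t : Fin p.r) : p.entry t ≠ 0 :=
  Fin.ne_zero_of_lt (p.lt _ (Finset.orderEmbOfFin_mem p.I rfl t))

/-- The index `i_t - 1` of a variable of `P_{k-1}`. -/
def Idx.entryPred (p : Idx (l + 1)) (t : Fin p.r) : Fin l := (p.entry t).pred (p.entry_ne_zero t)

/-- `f_i : P_{k-1} → P_k` is the algebra homomorphism with `x_j ↦ x_j` for `j < i` and
`x_j ↦ x_{j+1}` for `j ≥ i`. Here and below `k = l + 1`. -/
def f (i : Fin (l + 1)) : P l →ₐ[ZMod 2] P (l + 1) := MvPolynomial.rename i.succAbove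

/-- The monomial of `P_{k-1}` with exponents `a` is `(u + 1)`-compatible with `(i; I)`, for
`I ≠ ∅` and `0 ≤ u < r`. Since `t` starts from `0`, the binary digit `α_{r-t}` of the usual
convention becomes the digit at position `r - 1 - t`. -/
structure Compatible (p : Idx (l + 1)) (a : Fin l →₀ ℕ) (u : Fin p.r) : Prop where
  eq_of_lt : ∀ t, t < u → a (p.entryPred t) = 2 ^ p.r - 1
  lt_at : 2 ^ p.r - 1 < a (p.entryPred u)
  digit_at : ∀ t, t ≤ u → (a (p.entryPred u)).testBit (p.r - 1 - t) = true
  digit_of_gt : ∀ t, u < t → (a (p.entryPred t)).testBit (p.r - 1 - t) = true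

/-- A monomial is `u`-compatible with a given `(i; I)` for at most one `u`. -/
theorem Compatible.unique {p : Idx (l + 1)} {a : Fin l →₀ ℕ} {u v : Fin p.r}
    (hu : Compatible p a u) (hv : Compatible p a v) : u = v := by
  rcases lt_trichotomy u v with h | h | h
  · exact absurd (hv.eq_of_lt u h) hu.lt_at.ne'
  · exact h
  · exact absurd (hu.eq_of_lt v h) hv.lt_at.ne'

/-- The exponents of the monomial
`x_{(I,u)} = x_{i_u}^{2^{r-1} + … + 2^{r-u}} ∏_{u < t ≤ r} x_{i_t}^{2^{r-t}}`. -/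
def divisorExp (p : Idx (l + 1)) (u : Fin p.r) : Fin (l + 1) →₀ ℕ :=
  Finsupp.single (p.entry u) (∑ t ∈ Finset.Iic u, 2 ^ (p.r - 1 - (t : ℕ))) +
    ∑ t ∈ Finset.Ioi u, Finsupp.single (p.entry t) (2 ^ (p.r - 1 - (t : ℕ)))

open Classical in
/-- The value of `φ_{(i;I)}` on the monomial with exponents `a`. It is `f_i(x)` if `I = ∅`, it is
`x_i^{2^r-1} f_i(x) / x_{(I,u)}` if `x` is `u`-compatible with `(i; I)`, and otherwise it is `0`. -/
def phiMonomial (p : Idx (l + 1)) (a : Fin l →₀ ℕ) : P (l + 1) :=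
  if p.I = ∅ then f p.i (MvPolynomial.monomial a 1)
  else if h : ∃ u, Compatible p a u then
    (MvPolynomial.X p.i ^ (2 ^ p.r - 1) * f p.i (MvPolynomial.monomial a 1)).divMonomial
      (divisorExp p h.choose)
  else 0

/-- The `𝔽₂`-linear map `φ_{(i;I)} : P_{k-1} → P_k`. -/
def phi (p : Idx (l + 1)) : P l →ₗ[ZMod 2] P (l + 1) :=
  (MvPolynomial.basisMonomials (Fin l) (ZMod 2)).constr (ZMod 2) (phiMonomial p)

/-- `P_k^0`, the span of the monomials in which some variable does not occur. -/
def PZero (k : ℕ) : Submodule (ZMod 2) (P k) :=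
  Submodule.span (ZMod 2)
    {x | ∃ a : Fin k →₀ ℕ, (∃ j, a j = 0) ∧ x = MvPolynomial.monomial a 1}

/-- `Φ⁰(B) = ⋃_i φ_{(i;∅)}(B) = ⋃_i f_i(B)`. -/
def PhiZero (B : Set (P l)) : Set (P (l + 1)) :=
  ⋃ i : Fin (l + 1), f i '' B

/-- `Φ⁺(B) = ⋃_{ℓ(I) > 0} φ_{(i;I)}(B) \ P_k^0`. -/
def PhiPlus (B : Set (P l)) : Set (P (l + 1)) :=
  (⋃ (p : Idx (l + 1)) (_ : 0 < p.r), phi p '' B) \ PZero (l + 1)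

/-- `Φ(B) = Φ⁰(B) ∪ Φ⁺(B)`. -/
def Phi (B : Set (P l)) : Set (P (l + 1)) := PhiZero B ∪ PhiPlus B

end

end HitProblem

open HitProblem

/-! Put `l = k - 1`. Writing `n = 2^d m + l (2^d - 1)` with `d = d_{k-1}`, one has
`μ(2m + l) ≥ l`, so that a monomial of degree `n` in `l + 1` variables is hit unless each of its
`d` lowest binary digits occurs in exactly `l` exponents. The other monomials are the images of
polynomials of degree `m` under words in the maps `w ↦ x_1 ⋯ x̂_z ⋯ x_{l+1} w²`. Modulo hit
polynomials, such an image depends only on the length `d` and on the set `S` of letters `z` of the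
word; it is written `D_S(w)`.

Spanning: as `Sq¹(x_1 ⋯ x_{l+1} w²) = ∑_j x_1 ⋯ x̂_j ⋯ x_{l+1} (x_j w)²`, one has
`∑_j D_{S ∪ {j}}(x_j w) = 0`. These relations reduce every class to the classes of
`D_S(f_i(y))` with `i = min S`, which are the images of `φ_{(i;I)}` for `S = {i} ∪ I`. For `d = l`
no word contains all `l + 1` letters, and `D_S` has to be defined for the full set `S` by its
relations.

Independence: the substitution `x_i ↦ ∑_{j ∈ I} x_j` kills `D_S(w)` unless `S ⊆ {i} ∪ I`. The
values of all these substitutions form a triangular system, and they span a space which contains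
`2^{l+1} - 1` independent copies of `(QP_l)_n`. -/

namespace HitProblem

open MvPolynomial

section Monomials

variable {σ R : Type*} [CommSemiring R]

theorem mem_of_forall_monomial_mem {V : Submodule R (MvPolynomial σ R)} {w : MvPolynomial σ R}
    (h : ∀ a ∈ w.support, monomial a 1 ∈ V) : w ∈ V := by
  rw [w.as_sum]
  refine V.sum_mem fun a ha => ?_
  simpa [smul_monomial] using V.smul_mem (coeff a w) (h a ha)

theorem mem_of_isHomogeneous {V : Submodule R (MvPolynomial σ R)} {n : ℕ}
    (h : ∀ a : σ →₀ ℕ, a.degree = n → monomial a 1 ∈ V) {w : MvPolynomial σ R}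
    (hw : w.IsHomogeneous n) : w ∈ V :=
  mem_of_forall_monomial_mem fun a ha => h a (hw.degree_eq_sum_deg_support ha).symm

theorem homogeneousComponent_monomial (n : ℕ) (a : σ →₀ ℕ) (r : R) :
    homogeneousComponent n (monomial a r) = if a.degree = n then monomial a r else 0 := by
  rw [homogeneousComponent_of_mem (isHomogeneous_monomial r rfl)]
  simp only [eq_comm]

theorem homogeneousComponent_X_mul (n : ℕ) (j : σ) (w : MvPolynomial σ R) :
    homogeneousComponent (n + 1) (X j * w) = X j * homogeneousComponent n w := by
  induction w using induction_on' with
  | monomial a r =>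
    have h : X j * monomial a r = monomial (Finsupp.single j 1 + a) r := by
      rw [X, monomial_mul, one_mul]
    simp only [h, homogeneousComponent_monomial, map_add, Finsupp.degree_single, add_comm 1,
      add_left_inj, mul_ite, mul_zero]
  | add v w hv hw => simp only [mul_add, map_add, hv, hw]

end Monomials

section SteenrodSquares

variable {k : ℕ}

theorem Sq_zero (v : P k) : Sq k 0 v = v := by
  have h : ((Polynomial.aeval (0 : P k)).restrictScalars (ZMod 2)).comp (totalSq k) =
      AlgHom.id (ZMod 2) (P k) := by
    ext j
    simp [totalSq]
  simpa [Sq_apply, Polynomial.coeff_zero_eq_aeval_zero] using DFunLike.congr_fun h v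

theorem Sq_one_mul (v w : P k) : Sq k 1 (v * w) = v * Sq k 1 w + Sq k 1 v * w := by
  simp [Sq_mul, Finset.sum_range_succ, Sq_zero]

theorem Sq_sq (i : ℕ) (v : P k) :
    Sq k i (v ^ 2) = if Even i then Sq k (i / 2) v ^ 2 else 0 := by
  rw [Sq_apply, map_pow, ← Polynomial.map_frobenius_expand, Polynomial.coeff_map,
    Polynomial.coeff_expand two_pos, ← Sq_apply]
  simp only [even_iff_two_dvd, apply_ite (frobenius (P k) 2), frobenius_def, map_zero]

/-- The instability conditions of the Steenrod squares at a polynomial `v` of degree `n`: `Sq^i v`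
has degree `n + i`, it vanishes for `i > n`, and `Sq^n v = v²`. -/
structure IsUnstable (n : ℕ) (v : P k) : Prop where
  isHomogeneous : ∀ i, (Sq k i v).IsHomogeneous (n + i)
  natDegree_le : (totalSq k v).natDegree ≤ n
  top : Sq k n v = v ^ 2

namespace IsUnstable

theorem one : IsUnstable 0 (1 : P k) where
  isHomogeneous i := by
    rw [Sq_one]
    split_ifs with h
    · simpa [h] using isHomogeneous_one _ _
    · exact isHomogeneous_zero _ _ _
  natDegree_le := by simp
  top := by simp [Sq_one]

theorem X (j : Fin k) : IsUnstable 1 (X j : P k) where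
  isHomogeneous i := by
    rw [Sq_X]
    split_ifs with h₀ h₁
    · exact h₀ ▸ isHomogeneous_X _ _
    · simpa [h₁] using isHomogeneous_X_pow j 2
    · exact isHomogeneous_zero _ _ _
  natDegree_le := by
    rw [totalSq, aeval_X, add_comm]
    exact Polynomial.natDegree_linear_le
  top := by rw [Sq_X, if_neg one_ne_zero, if_pos rfl]

theorem mul {m n : ℕ} {v w : P k} (hv : IsUnstable m v) (hw : IsUnstable n w) :
    IsUnstable (m + n) (v * w) where
  isHomogeneous i := by
    rw [Sq_mul]
    refine IsHomogeneous.sum _ _ _ fun c hc => ?_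
    have hci : c + (i - c) = i := Nat.add_sub_cancel' (Finset.mem_range_succ_iff.1 hc)
    have h := (hv.isHomogeneous c).mul (hw.isHomogeneous (i - c))
    rwa [add_add_add_comm, hci] at h
  natDegree_le := by
    rw [map_mul]
    exact Polynomial.natDegree_mul_le.trans (add_le_add hv.natDegree_le hw.natDegree_le)
  top := by
    rw [Sq_apply, map_mul,
      Polynomial.coeff_mul_add_eq_of_natDegree_le hv.natDegree_le hw.natDegree_le, ← Sq_apply,
      ← Sq_apply, hv.top, hw.top, mul_pow]

end IsUnstable

theorem isUnstable_monomial (a : Fin k →₀ ℕ) : IsUnstable a.degree (monomial a 1 : P k) := by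
  have hadd (a b : Fin k →₀ ℕ) : (monomial (a + b) 1 : P k) = monomial a 1 * monomial b 1 := by
    rw [monomial_mul, one_mul]
  induction a using Finsupp.induction_linear with
  | zero => simpa using IsUnstable.one
  | add a b ha hb => exact map_add (Finsupp.degree (R := ℕ)) a b ▸ hadd a b ▸ ha.mul hb
  | single j m =>
    induction m with
    | zero => simpa using IsUnstable.one
    | succ m ih =>
      rw [Finsupp.degree_single] at ih ⊢
      rw [Finsupp.single_add, hadd]
      exact ih.mul (.X j)

theorem Sq_isHomogeneous {n : ℕ} (i : ℕ) {w : P k} (hw : w.IsHomogeneous n) :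
    (Sq k i w).IsHomogeneous (n + i) := by
  suffices w ∈ (homogeneousSubmodule (Fin k) (ZMod 2) (n + i)).comap (Sq k i) from this
  refine mem_of_isHomogeneous (fun a ha => ?_) hw
  exact ha ▸ (isUnstable_monomial a).isHomogeneous i

/-- Squaring, which is linear over `𝔽₂`. -/
noncomputable def squareLin (k : ℕ) : P k →ₗ[ZMod 2] P k :=
  (frobenius (P k) 2).toAddMonoidHom.toZModLinearMap 2

theorem Sq_eq_sq {n : ℕ} {w : P k} (hw : w.IsHomogeneous n) : Sq k n w = w ^ 2 := by
  suffices w ∈ LinearMap.eqLocus (Sq k n) (squareLin k) from this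
  refine mem_of_isHomogeneous (fun a ha => ?_) hw
  exact ha ▸ (isUnstable_monomial a).top

theorem homogeneousComponent_Sq (i n : ℕ) (w : P k) :
    homogeneousComponent n (Sq k i w) =
      if i ≤ n then Sq k i (homogeneousComponent (n - i) w) else 0 := by
  induction w using induction_on' with
  | monomial a r =>
    rw [homogeneousComponent_of_mem (Sq_isHomogeneous i (isHomogeneous_monomial r rfl)),
      homogeneousComponent_monomial]
    split_ifs <;> first | rfl | omega
  | add v w hv hw =>
    simp only [map_add, hv, hw]
    split_ifs <;> simp

end SteenrodSquares

section HitPolynomials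

variable {k k' : ℕ}

theorem Sq_mem_hit {i : ℕ} (hi : 0 < i) (v : P k) : Sq k i v ∈ hit k :=
  Submodule.mem_iSup_of_mem (⟨i, hi⟩ : {i : ℕ // 0 < i}) ⟨v, rfl⟩

theorem hit_le {V : Submodule (ZMod 2) (P k)} (h : ∀ i v, 0 < i → Sq k i v ∈ V) : hit k ≤ V :=
  iSup_le fun i => LinearMap.range_le_iff_comap.2 <| eq_top_iff.2 fun v _ => h i v i.2

theorem homogeneousComponent_mem_hit (n : ℕ) {w : P k} (hw : w ∈ hit k) :
    homogeneousComponent n w ∈ hit k := by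
  refine hit_le (V := (hit k).comap (homogeneousComponent n)) (fun i v hi => ?_) hw
  rw [Submodule.mem_comap, homogeneousComponent_Sq]
  split_ifs
  · exact Sq_mem_hit hi _
  · exact zero_mem _

theorem mem_of_mem_hit {V : Submodule (ZMod 2) (P k)} {n : ℕ}
    (h : ∀ i m (v : P k), 0 < i → m + i = n → v.IsHomogeneous m → Sq k i v ∈ V)
    {w : P k} (hw : w ∈ hit k) (hn : w.IsHomogeneous n) : w ∈ V := by
  rw [← homogeneousComponent_eq_self hn]
  refine hit_le (V := V.comap (homogeneousComponent n)) (fun i v hi => ?_) hw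
  rw [Submodule.mem_comap, homogeneousComponent_Sq]
  split_ifs with hin
  · exact h i (n - i) _ hi (by omega) (homogeneousComponent_isHomogeneous _ _)
  · exact zero_mem _

/-- A substitution of the variables by sums of variables. Such substitutions are the ones given by
matrices over `𝔽₂`, and they commute with the Steenrod squares. -/
def IsLinearSubst (g : P k →ₐ[ZMod 2] P k') : Prop :=
  ∀ j, ∃ A : Finset (Fin k'), g (X j) = ∑ s ∈ A, X s

theorem totalSq_sum_X (A : Finset (Fin k)) :
    totalSq k (∑ j ∈ A, X j) = Polynomial.C (∑ j ∈ A, X j) +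
      Polynomial.C ((∑ j ∈ A, X j) ^ 2) * Polynomial.X := by
  rw [map_sum, sum_pow_char]
  simp only [totalSq, aeval_X, map_sum, Finset.sum_add_distrib, Finset.sum_mul]

namespace IsLinearSubst

variable {g : P k →ₐ[ZMod 2] P k'}

theorem map_Sq (hg : IsLinearSubst g) (i : ℕ) (w : P k) : g (Sq k i w) = Sq k' i (g w) := by
  have h : (Polynomial.mapAlgHom g).comp (totalSq k) = (totalSq k').comp g := by
    ext1 j
    obtain ⟨A, hA⟩ := hg j
    rw [AlgHom.comp_apply, AlgHom.comp_apply, hA, totalSq_sum_X, ← hA]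
    simp [totalSq]
  simpa [Sq_apply] using congrArg (Polynomial.coeff · i) (DFunLike.congr_fun h w)

theorem map_mem_hit (hg : IsLinearSubst g) {w : P k} (hw : w ∈ hit k) : g w ∈ hit k' :=
  hit_le (V := (hit k').comap g.toLinearMap)
    (fun i v hi => by simpa [hg.map_Sq] using Sq_mem_hit hi (g v)) hw

theorem isHomogeneous_map (hg : IsLinearSubst g) {n : ℕ} {w : P k} (hw : w.IsHomogeneous n) :
    (g w).IsHomogeneous n := by
  have h : g = aeval fun j => g (X j) := by ext1 j; simp
  rw [h]
  refine one_mul n ▸ hw.aeval (fun j => g (X j)) fun j => ?_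
  obtain ⟨A, hA⟩ := hg j
  exact hA ▸ IsHomogeneous.sum _ _ _ fun s _ => isHomogeneous_X _ _

end IsLinearSubst

end HitPolynomials

section UpKameko

variable {k : ℕ}

/-- The squarefree monomial `x_J = ∏_{j ∈ J} x_j`. -/
noncomputable def varProd (J : Finset (Fin k)) : P k := ∏ j ∈ J, X j

theorem varProd_isHomogeneous (J : Finset (Fin k)) : (varProd J).IsHomogeneous J.card := by
  simpa [varProd] using IsHomogeneous.prod J X (fun _ => 1) fun j _ => isHomogeneous_X (ZMod 2) j

theorem X_mul_varProd_erase {J : Finset (Fin k)} {j : Fin k} (hj : j ∈ J) :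
    X j * varProd (J.erase j) = varProd J :=
  Finset.mul_prod_erase J X hj

theorem varProd_mul_varProd {J C : Finset (Fin k)} (h : C ⊆ J) :
    varProd J * varProd C = varProd (J \ C) * varProd C ^ 2 := by
  rw [varProd, ← Finset.prod_sdiff h, ← varProd, ← varProd]
  ring

theorem totalSq_varProd (J : Finset (Fin k)) :
    totalSq k (varProd J) = ∑ C ∈ J.powerset,
      Polynomial.C (varProd (J \ C) * varProd C ^ 2) * Polynomial.X ^ C.card := by
  have h : totalSq k (varProd J) = Polynomial.C (varProd J) *
      ∏ j ∈ J, (1 + Polynomial.C (X j) * Polynomial.X) := by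
    rw [varProd, map_prod, map_prod, ← Finset.prod_mul_distrib]
    refine Finset.prod_congr rfl fun j _ => ?_
    rw [totalSq, aeval_X, map_pow]
    ring
  rw [h, Finset.prod_one_add, Finset.mul_sum]
  refine Finset.sum_congr rfl fun C hC => ?_
  rw [← varProd_mul_varProd (Finset.mem_powerset.1 hC), Finset.prod_mul_distrib,
    Finset.prod_const, map_mul, varProd, varProd, map_prod, map_prod, mul_assoc]

/-- The up Kameko map `w ↦ x_J w²`. -/
noncomputable def upKameko (J : Finset (Fin k)) : P k →ₗ[ZMod 2] P k :=
  (LinearMap.mulLeft (ZMod 2) (varProd J)).comp (squareLin k)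

theorem upKameko_apply (J : Finset (Fin k)) (w : P k) : upKameko J w = varProd J * w ^ 2 := rfl

theorem upKameko_isHomogeneous {n : ℕ} (J : Finset (Fin k)) {w : P k} (hw : w.IsHomogeneous n) :
    (upKameko J w).IsHomogeneous (2 * n + J.card) := by
  rw [add_comm, mul_comm]
  exact (varProd_isHomogeneous J).mul (hw.pow 2)

theorem Sq_upKameko (i : ℕ) (J : Finset (Fin k)) (v : P k) :
    Sq k i (upKameko J v) = ∑ C ∈ J.powerset with C.card ≤ i ∧ Even (i - C.card),
      upKameko (J \ C) (varProd C * Sq k ((i - C.card) / 2) v) := by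
  rw [upKameko_apply, Sq_apply, map_mul, totalSq_varProd, Finset.sum_mul,
    Polynomial.finsetSum_coeff, Finset.sum_filter]
  refine Finset.sum_congr rfl fun C _ => ?_
  rw [mul_assoc, Polynomial.coeff_C_mul, Polynomial.coeff_X_pow_mul', ← Sq_apply, Sq_sq,
    upKameko_apply, mul_pow, ← mul_assoc, ite_and, mul_ite, mul_ite, mul_zero]

end UpKameko

section MersenneSums

/-- `n` is a sum of `s` numbers of the form `2^i - 1`, where `i = 0` is allowed. In terms of the
usual function `μ` this says that `μ(n) ≤ s`. -/
def IsMersenneSum (s n : ℕ) : Prop :=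
  ∃ c : Multiset ℕ, c.card = s ∧ (c.map fun i => 2 ^ i - 1).sum = n

theorem isMersenneSum_zero_right (s : ℕ) : IsMersenneSum s 0 :=
  ⟨Multiset.replicate s 0, by simp, by simp⟩

theorem isMersenneSum_self (n : ℕ) : IsMersenneSum n n :=
  ⟨Multiset.replicate n 1, by simp, by simp⟩

theorem IsMersenneSum.add {s t m n : ℕ} (hm : IsMersenneSum s m) (hn : IsMersenneSum t n) :
    IsMersenneSum (s + t) (m + n) := by
  obtain ⟨a, rfl, rfl⟩ := hm
  obtain ⟨b, rfl, rfl⟩ := hn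
  exact ⟨a + b, by simp, by simp⟩

theorem IsMersenneSum.mono {s t n : ℕ} (hst : s ≤ t) (h : IsMersenneSum s n) :
    IsMersenneSum t n := by
  simpa [Nat.add_sub_cancel' hst] using h.add (isMersenneSum_zero_right (t - s))

theorem isMersenneSum_one (i : ℕ) : IsMersenneSum 1 (2 ^ i - 1) := ⟨{i}, by simp, by simp⟩

theorem two_pow_succ_sub_one (i : ℕ) : 2 ^ (i + 1) - 1 = 2 * (2 ^ i - 1) + 1 := by
  have := Nat.one_le_two_pow (n := i)
  rw [pow_succ]
  omega

theorem IsMersenneSum.of_succ {s n : ℕ} (h : IsMersenneSum s (n + 1)) :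
    IsMersenneSum (s + 1) n := by
  obtain ⟨c, rfl, hc⟩ := h
  obtain ⟨i, hi, hi0⟩ : ∃ i ∈ c, i ≠ 0 := by
    by_contra! h0
    rw [Multiset.eq_replicate_card.2 h0] at hc
    simp at hc
  obtain ⟨c, rfl⟩ := Multiset.exists_cons_of_mem hi
  obtain ⟨j, rfl⟩ := Nat.exists_eq_succ_of_ne_zero hi0
  refine ⟨j ::ₘ j ::ₘ c, by simp, ?_⟩
  simp only [Multiset.map_cons, Multiset.sum_cons, Nat.succ_eq_add_one,
    two_pow_succ_sub_one] at hc ⊢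
  omega

theorem IsMersenneSum.of_add {s t n : ℕ} (h : IsMersenneSum s (n + t)) :
    IsMersenneSum (s + t) n := by
  induction t generalizing s with
  | zero => exact h
  | succ t ih => exact Nat.add_right_comm s 1 t ▸ ih h.of_succ

theorem IsMersenneSum.exists_eq_two_mul_add {s n : ℕ} (h : IsMersenneSum s n) :
    ∃ t m, t ≤ s ∧ n = 2 * m + t ∧ IsMersenneSum t m := by
  obtain ⟨c, rfl, rfl⟩ := h
  induction c using Multiset.induction_on with
  | empty => exact ⟨0, 0, by simp, by simp, isMersenneSum_zero_right 0⟩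
  | cons i c ih =>
    obtain ⟨t, m, ht, hn, hm⟩ := ih
    rcases i with _ | i
    · exact ⟨t, m, by simpa using ht.trans (Nat.le_succ _), by simpa using hn, hm⟩
    · refine ⟨t + 1, m + (2 ^ i - 1), by simpa using ht, ?_, hm.add (isMersenneSum_one i)⟩
      rw [Multiset.map_cons, Multiset.sum_cons, hn, two_pow_succ_sub_one]
      ring

/-- Merging two equal powers of `2` into one shows that the binary expansion of a number is its
shortest expression as a sum of powers of `2`. -/
theorem card_le_card_of_sum_two_pow_eq {S : Finset ℕ} {c : Multiset ℕ}
    (h : ∑ i ∈ S, 2 ^ i = (c.map (2 ^ ·)).sum) : S.card ≤ c.card := by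
  induction hc : c.card using Nat.strong_induction_on generalizing c with
  | _ s ih =>
    subst hc
    by_cases hnodup : c.Nodup
    · have : S = ⟨c, hnodup⟩ := by
        rw [← Finset.toFinset_bitIndices_sum_two_pow S, h]
        exact Finset.toFinset_bitIndices_sum_two_pow ⟨c, hnodup⟩
      rw [this, Finset.card_mk]
    · obtain ⟨i, hi⟩ : ∃ i, i ::ₘ i ::ₘ 0 ≤ c := by
        simpa [Multiset.nodup_iff_le] using hnodup
      obtain ⟨c, rfl⟩ := Multiset.le_iff_exists_add.1 hi
      have := ih ((i + 1) ::ₘ c).card (by simp) (c := (i + 1) ::ₘ c) (by simp [h]; ring) rfl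
      simp only [Multiset.cons_add, Multiset.card_cons, zero_add] at this ⊢
      omega

theorem sum_two_pow_add_two_pow_ne {S : Finset ℕ} {D : ℕ} {c : Multiset ℕ} (hD : 1 ≤ D)
    (hS : ∀ i ∈ S, D ≤ i) (hcard : c.card = S.card) :
    ∑ i ∈ S, 2 ^ i + 2 ^ D ≠ (c.map (2 ^ ·)).sum + 1 := by
  intro h
  have hD2 : 2 ≤ 2 ^ D := Nat.le_self_pow (by omega) 2
  set T : Finset ℕ := (2 ^ D - 1).bitIndices.toFinset
  have hT : ∑ i ∈ T, 2 ^ i = 2 ^ D - 1 := Finset.sum_toFinset_bitIndices_two_pow _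
  have hdisj : Disjoint S T := Finset.disjoint_left.2 fun i hiS hiT => by
    have h₁ := Nat.two_pow_le_of_mem_bitIndices (List.mem_toFinset.1 hiT)
    have h₂ : 2 ^ D ≤ 2 ^ i := Nat.pow_le_pow_right two_pos (hS i hiS)
    omega
  have hle := card_le_card_of_sum_two_pow_eq (S := S ∪ T) (c := c) (by
    rw [Finset.sum_union hdisj, hT]
    omega)
  have hT0 : T.card ≠ 0 := fun h0 => by
    rw [Finset.card_eq_zero.1 h0, Finset.sum_empty] at hT
    omega
  rw [Finset.card_union_of_disjoint hdisj] at hle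
  omega

theorem sum_map_two_pow_sub_one_add_card (c : Multiset ℕ) :
    (c.map fun i => 2 ^ i - 1).sum + c.card = (c.map (2 ^ ·)).sum := by
  induction c using Multiset.induction_on with
  | empty => rfl
  | cons i c ih =>
    have := Nat.one_le_two_pow (n := i)
    simp only [Multiset.map_cons, Multiset.sum_cons, Multiset.card_cons]
    omega

/-- The number `μ(n)`, the least number of summands in an expression of `n` as a sum of numbers
of the form `2^i - 1`. -/
noncomputable def mu (n : ℕ) : ℕ := sInf {s | IsMersenneSum s n}

theorem IsMersenneSum.mu_le {s n : ℕ} (h : IsMersenneSum s n) : mu n ≤ s := Nat.sInf_le h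

theorem isMersenneSum_mu (n : ℕ) : IsMersenneSum (mu n) n :=
  Nat.sInf_mem (s := {s | IsMersenneSum s n}) ⟨n, isMersenneSum_self n⟩

theorem card_lt_mu {S : Finset ℕ} {D : ℕ} (hD : 1 ≤ D) (hS : ∀ i ∈ S, D ≤ i) :
    S.card < mu (∑ i ∈ S, (2 ^ i - 1) + (2 ^ D - 1)) := by
  by_contra! hle
  obtain ⟨c, hcard, hc⟩ := (isMersenneSum_mu _).mono hle
  have hSsum := sum_map_two_pow_sub_one_add_card S.val
  have hcsum := sum_map_two_pow_sub_one_add_card c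
  have hD1 := Nat.one_le_two_pow (n := D)
  refine sum_two_pow_add_two_pow_ne (c := c) hD hS hcard ?_
  simp only [Finset.sum, Finset.card] at *
  omega

theorem le_mu_two_mul_add {l n : ℕ} (hn : l ≤ mu n) : l ≤ mu (2 * n + l) := by
  by_contra! hlt
  obtain ⟨t, q, ht, hq, hsum⟩ := (isMersenneSum_mu (2 * n + l)).exists_eq_two_mul_add
  obtain rfl : q = n + (l - t) / 2 := by omega
  have := hsum.of_add.mu_le
  omega

end MersenneSums

section ChiTrick

variable {k : ℕ}

/-- The `T`-linear extension of the total square to `P_k[T]`. -/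
noncomputable def totalSqExt (k : ℕ) : Polynomial (P k) →+* Polynomial (P k) :=
  Polynomial.eval₂RingHom (totalSq k).toRingHom Polynomial.X

theorem totalSqExt_C (w : P k) : totalSqExt k (Polynomial.C w) = totalSq k w := by
  simp [totalSqExt]

theorem totalSqExt_X : totalSqExt k Polynomial.X = Polynomial.X := by simp [totalSqExt]

theorem coeff_totalSqExt_sub_mem_hit (n : ℕ) (q : Polynomial (P k)) :
    (totalSqExt k q).coeff n - q.coeff n ∈ hit k := by
  induction q using Polynomial.induction_on' with
  | add p q hp hq =>
    rw [map_add, Polynomial.coeff_add, Polynomial.coeff_add, add_sub_add_comm]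
    exact add_mem hp hq
  | monomial m w =>
    rw [← Polynomial.C_mul_X_pow_eq_monomial, map_mul, map_pow, totalSqExt_C, totalSqExt_X,
      Polynomial.coeff_mul_X_pow', Polynomial.coeff_C_mul_X_pow, ← Sq_apply]
    rcases lt_trichotomy m n with h | rfl | h
    · rw [if_pos h.le, if_neg h.ne', sub_zero]
      exact Sq_mem_hit (Nat.sub_pos_of_lt h) w
    · rw [if_pos le_rfl, if_pos rfl, Nat.sub_self, Sq_zero, sub_self]
      exact zero_mem _
    · rw [if_neg h.not_ge, if_neg h.ne, sub_zero]
      exact zero_mem _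

/-- The conjugate total square of the variable `x_j`, truncated to its first `C` terms. -/
noncomputable def conjSqX (C : ℕ) (j : Fin k) : Polynomial (P k) :=
  ∑ c ∈ Finset.range C, Polynomial.C (X j ^ 2 ^ c) * Polynomial.X ^ (2 ^ c - 1)

theorem totalSqExt_conjSqX_term (c : ℕ) (j : Fin k) :
    totalSqExt k (Polynomial.C (X j ^ 2 ^ c) * Polynomial.X ^ (2 ^ c - 1)) =
      Polynomial.C (X j ^ 2 ^ c) * Polynomial.X ^ (2 ^ c - 1) +
        Polynomial.C (X j ^ 2 ^ (c + 1)) * Polynomial.X ^ (2 ^ (c + 1) - 1) := by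
  have hexp : 2 ^ c + (2 ^ c - 1) = 2 ^ (c + 1) - 1 := by
    have := Nat.one_le_two_pow (n := c)
    omega
  rw [map_mul, totalSqExt_C, map_pow (totalSqExt k), totalSqExt_X,
    map_pow (totalSq k), totalSq, aeval_X, add_pow_char_pow, mul_pow, add_mul, ← map_pow,
    ← map_pow, mul_assoc, ← pow_add, hexp, ← pow_mul, ← pow_succ']

theorem totalSqExt_conjSqX (C : ℕ) (j : Fin k) :
    totalSqExt k (conjSqX (C + 1) j) = Polynomial.C (X j) +
      Polynomial.C (X j ^ 2 ^ (C + 1)) * Polynomial.X ^ (2 ^ (C + 1) - 1) := by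
  induction C with
  | zero =>
    rw [conjSqX, Finset.sum_range_one, totalSqExt_conjSqX_term]
    simp
  | succ C ih =>
    rw [conjSqX, Finset.sum_range_succ, map_add, ← conjSqX, ih, totalSqExt_conjSqX_term,
      add_assoc, ← add_assoc (Polynomial.C (X j ^ 2 ^ (C + 1)) * _), CharTwo.add_self_eq_zero,
      zero_add]

theorem dvd_prod_add_mul_sub_prod {R ι : Type*} [CommRing R] (J : Finset ι) (a b : ι → R)
    (t : R) : t ∣ ∏ j ∈ J, (a j + b j * t) - ∏ j ∈ J, a j := by
  simp only [← Ideal.mem_span_singleton, ← Ideal.Quotient.eq, map_prod, map_add, map_mul,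
    Ideal.Quotient.eq_zero_iff_mem.2 (Ideal.mem_span_singleton_self t), mul_zero, add_zero]

theorem isMersenneSum_of_coeff_prod_conjSqX_ne_zero {C n : ℕ} {J : Finset (Fin k)}
    (h : (∏ j ∈ J, conjSqX C j).coeff n ≠ 0) : IsMersenneSum J.card n := by
  induction J using Finset.induction_on generalizing n with
  | empty =>
    rw [Finset.prod_empty, Polynomial.coeff_one] at h
    exact (ite_ne_right_iff.1 h).1 ▸ isMersenneSum_zero_right 0
  | insert j J hj ih =>
    rw [Finset.prod_insert hj, Polynomial.coeff_mul] at h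
    obtain ⟨⟨a, b⟩, hab, hne⟩ := Finset.exists_ne_zero_of_sum_ne_zero h
    have ha := left_ne_zero_of_mul hne
    rw [conjSqX, Polynomial.finsetSum_coeff] at ha
    obtain ⟨c, -, hc⟩ := Finset.exists_ne_zero_of_sum_ne_zero ha
    rw [Polynomial.coeff_C_mul_X_pow] at hc
    obtain rfl : a = 2 ^ c - 1 := (ite_ne_right_iff.1 hc).1
    rw [Finset.card_insert_of_notMem hj, add_comm, ← Finset.HasAntidiagonal.mem_antidiagonal.1 hab]
    exact (isMersenneSum_one c).add (ih (right_ne_zero_of_mul hne))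

/-- The `χ`-trick: modulo hit polynomials, a Steenrod square may be moved from one factor of a
product to the other one if it is replaced by its conjugate. Here `w² = Sq^n w` is moved to `x_J`,
where the conjugate square of degree `n` vanishes. -/
theorem upKameko_mem_hit_of_card_lt_mu {n : ℕ} {J : Finset (Fin k)} {w : P k}
    (hw : w.IsHomogeneous n) (hJ : J.card < mu n) : upKameko J w ∈ hit k := by
  set χ : Polynomial (P k) := ∏ j ∈ J, conjSqX (n + 1) j
  have hχ : χ.coeff n = 0 := by
    by_contra h
    exact hJ.not_ge (isMersenneSum_of_coeff_prod_conjSqX_ne_zero h).mu_le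
  have hmem := coeff_totalSqExt_sub_mem_hit n (χ * Polynomial.C w)
  rw [Polynomial.coeff_mul_C, hχ, zero_mul, sub_zero, map_mul, totalSqExt_C] at hmem
  obtain ⟨q, hq⟩ := dvd_prod_add_mul_sub_prod J (fun j => Polynomial.C (X j : P k))
    (fun j => Polynomial.C (X j ^ 2 ^ (n + 1))) (Polynomial.X ^ (2 ^ (n + 1) - 1))
  have htotal : totalSqExt k χ =
      Polynomial.C (varProd J) + Polynomial.X ^ (2 ^ (n + 1) - 1) * q := by
    rw [map_prod, ← hq, varProd, map_prod, add_sub_cancel]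
    simp only [totalSqExt_conjSqX]
  have hlt : n < 2 ^ (n + 1) - 1 := by
    have := Nat.lt_two_pow_self (n := n + 1)
    omega
  rwa [htotal, add_mul, Polynomial.coeff_add, Polynomial.coeff_C_mul, ← Sq_apply, Sq_eq_sq hw,
    mul_assoc, Polynomial.coeff_X_pow_mul', if_neg hlt.not_ge, add_zero] at hmem

end ChiTrick

section KamekoDegree

variable {l m : ℕ}

/-- The degrees obtained from `m` by iterating `n ↦ 2n + l`, the degree of `x_1 ⋯ x_l w²` for a
polynomial `w` of degree `n`. -/
def kamekoDegree (l m : ℕ) : ℕ → ℕ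
  | 0 => m
  | e + 1 => 2 * kamekoDegree l m e + l

theorem kamekoDegree_eq (l m e : ℕ) : kamekoDegree l m e = 2 ^ e * m + l * (2 ^ e - 1) := by
  induction e with
  | zero => simp [kamekoDegree]
  | succ e ih =>
    rw [kamekoDegree, ih, two_pow_succ_sub_one, pow_succ]
    ring

theorem IsMersenneSum.two_mul_add_card {s n : ℕ} (h : IsMersenneSum s n) :
    IsMersenneSum s (2 * n + s) := by
  obtain ⟨c, rfl, rfl⟩ := h
  refine ⟨c.map (· + 1), c.card_map _, ?_⟩
  simp only [Multiset.map_map, Function.comp_apply, two_pow_succ_sub_one, Multiset.sum_map_add,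
    Multiset.sum_map_mul_left, Multiset.map_const', Multiset.sum_replicate, smul_eq_mul, mul_one]

theorem le_mu_kamekoDegree (hμ : l ≤ mu (2 * m + l)) (e : ℕ) :
    l ≤ mu (kamekoDegree l m (e + 1)) := by
  induction e with
  | zero => exact hμ
  | succ e ih => exact le_mu_two_mul_add ih

theorem upKameko_mem_hit_of_card_lt (hμ : l ≤ mu (2 * m + l)) {k e n : ℕ}
    {J : Finset (Fin k)} {w : P k} (hw : w.IsHomogeneous n) (hJ : J.card < l)
    (hn : J.card + 2 * n = kamekoDegree l m (e + 1)) : upKameko J w ∈ hit k := by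
  refine upKameko_mem_hit_of_card_lt_mu hw ?_
  by_contra! hle
  have hmu : mu (kamekoDegree l m (e + 1)) ≤ J.card := by
    rw [← hn, add_comm]
    exact ((isMersenneSum_mu n).mono hle).two_mul_add_card.mu_le
  exact absurd (le_mu_kamekoDegree hμ e) (hmu.trans_lt hJ).not_ge

end KamekoDegree

/-- The class of a polynomial modulo hit polynomials. -/
noncomputable abbrev hitClass {k : ℕ} : P k →ₗ[ZMod 2] P k ⧸ hit k := (hit k).mkQ

theorem hitClass_eq_zero {k : ℕ} {w : P k} : hitClass w = 0 ↔ w ∈ hit k :=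
  Submodule.Quotient.mk_eq_zero _

theorem hitClass_eq_hitClass {k : ℕ} {v w : P k} : hitClass v = hitClass w ↔ v - w ∈ hit k :=
  Submodule.Quotient.eq _

section UpKamekoModHits

variable {k l m e : ℕ} {J : Finset (Fin k)} {w : P k}

theorem upKameko_isHomogeneous_succ (hJ : J.card = l)
    (hw : w.IsHomogeneous (kamekoDegree l m e)) :
    (upKameko J w).IsHomogeneous (kamekoDegree l m (e + 1)) := by
  subst hJ
  exact upKameko_isHomogeneous J hw

theorem upKameko_mem_hit (hμ : l ≤ mu (2 * m + l)) (hJ : J.card = l) (hw : w ∈ hit k)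
    (hdeg : w.IsHomogeneous (kamekoDegree l m e)) : upKameko J w ∈ hit k := by
  refine mem_of_mem_hit (V := (hit k).comap (upKameko J)) (fun i n v hi hn hv => ?_) hw hdeg
  have hSq := Sq_upKameko (2 * i) J v
  rw [← Finset.add_sum_erase _ _ (by simp : ∅ ∈ _), ← sub_eq_iff_eq_add] at hSq
  have hempty : upKameko (J \ ∅) (varProd ∅ * Sq k ((2 * i - (∅ : Finset (Fin k)).card) / 2) v) =
      upKameko J (Sq k i v) := by simp [varProd]
  rw [Submodule.mem_comap, ← hempty, ← hSq]
  refine sub_mem (Sq_mem_hit (by omega) _) (Submodule.sum_mem _ fun C hC => ?_)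
  simp only [Finset.mem_erase, Finset.mem_filter, Finset.mem_powerset] at hC
  obtain ⟨hC0, hCJ, hCi, b, hb⟩ := hC
  have hpos := Finset.card_pos.2 (Finset.nonempty_iff_ne_empty.2 hC0)
  have hcard := Finset.card_sdiff_add_card_eq_card hCJ
  refine upKameko_mem_hit_of_card_lt (e := e) hμ
    ((varProd_isHomogeneous C).mul (Sq_isHomogeneous _ hv)) (by omega) ?_
  rw [kamekoDegree]
  omega

theorem hitClass_upKameko_congr (hμ : l ≤ mu (2 * m + l)) (hJ : J.card = l) {v : P k}
    (h : hitClass v = hitClass w) (hv : v.IsHomogeneous (kamekoDegree l m e))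
    (hw : w.IsHomogeneous (kamekoDegree l m e)) :
    hitClass (upKameko J v) = hitClass (upKameko J w) := by
  rw [hitClass_eq_hitClass] at h ⊢
  rw [← map_sub]
  exact upKameko_mem_hit hμ hJ h (hv.sub hw)

theorem X_mul_upKameko_erase {j : Fin k} (hj : j ∈ J) (w : P k) :
    X j * upKameko (J.erase j) w = upKameko J w := by
  rw [upKameko_apply, upKameko_apply, ← mul_assoc, X_mul_varProd_erase hj]

theorem X_mul_upKameko {j : Fin k} (hj : j ∈ J) (w : P k) :
    X j * upKameko J w = upKameko (J.erase j) (X j * w) := by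
  rw [upKameko_apply, upKameko_apply, ← X_mul_varProd_erase hj]
  ring

theorem X_mul_upKameko_isHomogeneous (hJ : J.card + 1 = l) (j : Fin k)
    (hw : w.IsHomogeneous (kamekoDegree l m e)) :
    (X j * upKameko J w).IsHomogeneous (kamekoDegree l m (e + 1)) := by
  have h := (isHomogeneous_X (ZMod 2) j).mul (upKameko_isHomogeneous J hw)
  rwa [add_comm, add_assoc, hJ] at h

theorem X_mul_upKameko_mem_hit (hμ : l ≤ mu (2 * m + l)) (hJ : J.card + 1 = l) {j : Fin k}
    (hj : j ∈ J) (hw : w.IsHomogeneous (kamekoDegree l m e)) :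
    X j * upKameko J w ∈ hit k := by
  have hcard := Finset.card_erase_add_one hj
  rw [X_mul_upKameko hj]
  refine upKameko_mem_hit_of_card_lt (e := e) hμ ((isHomogeneous_X (ZMod 2) j).mul hw)
    (by omega) ?_
  rw [kamekoDegree]
  omega

end UpKamekoModHits

section Words

variable {l m e : ℕ}

/-- The up Kameko map `w ↦ x_1 ⋯ x̂_z ⋯ x_{l+1} w²` which omits the variable `x_z`. -/
noncomputable abbrev upKamekoOmit (z : Fin (l + 1)) : P (l + 1) →ₗ[ZMod 2] P (l + 1) :=
  upKameko (Finset.univ.erase z)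

theorem card_univ_erase (z : Fin (l + 1)) : (Finset.univ.erase z).card = l := by simp

/-- The composition of the maps `upKamekoOmit z` for the letters `z` of a word; the first letter
belongs to the map that is applied last. -/
noncomputable def upKamekoWord (L : List (Fin (l + 1))) : Module.End (ZMod 2) (P (l + 1)) :=
  (L.map upKamekoOmit).prod

@[simp]
theorem upKamekoWord_nil (w : P (l + 1)) : upKamekoWord [] w = w := rfl

theorem upKamekoWord_cons (z : Fin (l + 1)) (L : List (Fin (l + 1))) (w : P (l + 1)) :
    upKamekoWord (z :: L) w = upKamekoOmit z (upKamekoWord L w) := by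
  rw [upKamekoWord, List.map_cons, List.prod_cons, Module.End.mul_apply, upKamekoWord]

theorem upKamekoWord_append (L L' : List (Fin (l + 1))) (w : P (l + 1)) :
    upKamekoWord (L ++ L') w = upKamekoWord L (upKamekoWord L' w) := by
  rw [upKamekoWord, List.map_append, List.prod_append, Module.End.mul_apply, upKamekoWord,
    upKamekoWord]

theorem upKamekoWord_isHomogeneous (L : List (Fin (l + 1))) {w : P (l + 1)}
    (hw : w.IsHomogeneous (kamekoDegree l m e)) :
    (upKamekoWord L w).IsHomogeneous (kamekoDegree l m (e + L.length)) := by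
  induction L with
  | nil => exact hw
  | cons z L ih =>
    rw [upKamekoWord_cons]
    exact upKameko_isHomogeneous_succ (card_univ_erase z) ih

theorem upKamekoWord_mem_hit (hμ : l ≤ mu (2 * m + l)) (L : List (Fin (l + 1))) {w : P (l + 1)}
    (h : w ∈ hit (l + 1)) (hw : w.IsHomogeneous (kamekoDegree l m e)) :
    upKamekoWord L w ∈ hit (l + 1) := by
  induction L with
  | nil => exact h
  | cons z L ih =>
    rw [upKamekoWord_cons]
    exact upKameko_mem_hit hμ (card_univ_erase z) ih (upKamekoWord_isHomogeneous L hw)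

theorem sum_upKamekoOmit_X_mul_mem_hit (w : P (l + 1)) :
    ∑ j, upKamekoOmit j (X j * w) ∈ hit (l + 1) := by
  have hfilter : ({C ∈ (Finset.univ : Finset (Fin (l + 1))).powerset |
      C.card ≤ 1 ∧ Even (1 - C.card)}) = Finset.powersetCard 1 Finset.univ := by
    ext C
    simp only [Finset.mem_filter, Finset.mem_powerset, Finset.mem_powersetCard]
    refine and_congr_right fun _ => ⟨fun ⟨hle, heven⟩ => ?_, fun h => by simp [h]⟩
    interval_cases C.card
    · simp at heven
    · rfl
  have hSq : Sq (l + 1) 1 (upKameko Finset.univ w) = ∑ j, upKamekoOmit j (X j * w) := by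
    rw [Sq_upKameko, hfilter, Finset.powersetCard_one, Finset.sum_map]
    simp [varProd, Sq_zero, Finset.sdiff_singleton_eq_erase]
  exact hSq ▸ Sq_mem_hit one_pos _

theorem sum_upKamekoWord_replicate_mem_hit (c : ℕ) (w : P (l + 1)) :
    ∑ j, upKamekoWord (List.replicate (c + 1) j) (X j * w) ∈ hit (l + 1) := by
  obtain ⟨v, hv⟩ : ∃ v, ∀ j, X j * v = upKamekoWord (List.replicate c j) (X j * w) := by
    induction c with
    | zero => exact ⟨w, fun j => rfl⟩
    | succ c ih =>
      obtain ⟨v, hv⟩ := ih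
      refine ⟨upKameko Finset.univ v, fun j => ?_⟩
      rw [X_mul_upKameko (Finset.mem_univ j), hv, List.replicate_succ, upKamekoWord_cons]
  simpa only [hv, List.replicate_succ, upKamekoWord_cons]
    using sum_upKamekoOmit_X_mul_mem_hit v

theorem hitClass_upKamekoWord_replicate_swap (hμ : l ≤ mu (2 * m + l)) (c : ℕ)
    (p q : Fin (l + 1)) {w : P (l + 1)} (hw : w.IsHomogeneous (kamekoDegree l m e)) :
    hitClass (upKamekoWord (List.replicate (c + 1) p) (upKamekoOmit q w)) =
      hitClass (upKamekoWord (List.replicate (c + 1) q) (upKamekoOmit p w)) := by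
  rcases eq_or_ne p q with rfl | hpq
  · rfl
  have hp : p ∈ (Finset.univ.erase q : Finset (Fin (l + 1))) := by simp [hpq]
  have hq : q ∈ (Finset.univ.erase p : Finset (Fin (l + 1))) := by simp [hpq.symm]
  have hcard := (Finset.card_erase_add_one hp).trans (card_univ_erase q)
  have hsum := hitClass_eq_zero.2 (sum_upKamekoWord_replicate_mem_hit c
    (upKameko ((Finset.univ.erase q).erase p) w))
  rw [map_sum, Fintype.sum_eq_add p q hpq fun j ⟨hjp, hjq⟩ => hitClass_eq_zero.2 <|
      upKamekoWord_mem_hit hμ _ (X_mul_upKameko_mem_hit hμ hcard (by simp [hjp, hjq]) hw)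
        (X_mul_upKameko_isHomogeneous hcard j hw),
    X_mul_upKameko_erase hp, Finset.erase_right_comm, X_mul_upKameko_erase hq] at hsum
  rwa [add_eq_zero_iff_eq_neg, ZModModule.neg_eq_self] at hsum

theorem hitClass_upKamekoWord_perm (hμ : l ≤ mu (2 * m + l)) {L L' : List (Fin (l + 1))}
    (h : L.Perm L') {w : P (l + 1)} (hw : w.IsHomogeneous (kamekoDegree l m e)) :
    hitClass (upKamekoWord L w) = hitClass (upKamekoWord L' w) := by
  induction h with
  | nil => rfl
  | @cons z L L' hL ih =>
    rw [upKamekoWord_cons, upKamekoWord_cons]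
    exact hitClass_upKameko_congr hμ (card_univ_erase z) ih (upKamekoWord_isHomogeneous L hw)
      (hL.length_eq ▸ upKamekoWord_isHomogeneous L' hw)
  | swap p q L =>
    simpa only [List.replicate, upKamekoWord_cons, upKamekoWord_nil] using
      hitClass_upKamekoWord_replicate_swap hμ 0 q p (upKamekoWord_isHomogeneous L hw)
  | trans _ _ ih₁ ih₂ => exact ih₁.trans ih₂

theorem hitClass_upKamekoWord_cons_congr (hμ : l ≤ mu (2 * m + l)) {L : List (Fin (l + 1))}
    {p q : Fin (l + 1)} (hp : p ∈ L) (hq : q ∈ L) {w : P (l + 1)}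
    (hw : w.IsHomogeneous (kamekoDegree l m e)) :
    hitClass (upKamekoWord (p :: L) w) = hitClass (upKamekoWord (q :: L) w) := by
  rcases eq_or_ne p q with rfl | hpq
  · rfl
  have hperm : L.Perm (p :: q :: (L.erase p).erase q) :=
    (List.perm_cons_erase hp).trans
      ((List.perm_cons_erase ((List.mem_erase_of_ne hpq.symm).2 hq)).cons p)
  rw [hitClass_upKamekoWord_perm hμ (hperm.cons p) hw,
    hitClass_upKamekoWord_perm hμ ((hperm.trans (List.Perm.swap q p _)).cons q) hw]
  simpa only [List.replicate, upKamekoWord_cons, upKamekoWord_nil] using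
    hitClass_upKamekoWord_replicate_swap hμ 1 p q (upKamekoWord_isHomogeneous _ hw)

theorem hitClass_upKamekoWord_append_eq (hμ : l ≤ mu (2 * m + l)) {E D : List (Fin (l + 1))}
    {i : Fin (l + 1)} (hi : i ∈ D) (hE : E ⊆ D) {w : P (l + 1)}
    (hw : w.IsHomogeneous (kamekoDegree l m e)) :
    hitClass (upKamekoWord (E ++ D) w) =
      hitClass (upKamekoWord (List.replicate E.length i ++ D) w) := by
  induction E with
  | nil => rfl
  | cons z E ih =>
    obtain ⟨hz, hE⟩ := List.cons_subset.1 hE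
    have hED := upKamekoWord_isHomogeneous (E ++ D) hw
    have hiD := upKamekoWord_isHomogeneous (List.replicate E.length i ++ D) hw
    rw [List.length_append] at hED
    rw [List.length_append, List.length_replicate] at hiD
    rw [List.cons_append, upKamekoWord_cons,
      hitClass_upKameko_congr hμ (card_univ_erase z) (ih hE) hED hiD, ← upKamekoWord_cons]
    exact hitClass_upKamekoWord_cons_congr hμ (List.mem_append_right _ hz)
      (List.mem_append_right _ hi) hw

theorem hitClass_upKamekoWord_eq_dedup (hμ : l ≤ mu (2 * m + l)) {L : List (Fin (l + 1))}
    {i : Fin (l + 1)} (hi : i ∈ L) {w : P (l + 1)}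
    (hw : w.IsHomogeneous (kamekoDegree l m e)) :
    hitClass (upKamekoWord L w) = hitClass
      (upKamekoWord (List.replicate (L.length - L.dedup.length) i ++ L.dedup) w) := by
  obtain ⟨E, hE⟩ := (List.dedup_sublist L).exists_perm_append
  have hsub : E ⊆ L.dedup := fun z hz =>
    List.mem_dedup.2 (hE.mem_iff.2 (List.mem_append_right _ hz))
  have hlen : E.length = L.length - L.dedup.length := by
    rw [hE.length_eq, List.length_append]
    omega
  rw [← hlen, hitClass_upKamekoWord_perm hμ (hE.trans List.perm_append_comm) hw]
  exact hitClass_upKamekoWord_append_eq hμ (List.mem_dedup.2 hi) hsub hw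

theorem hitClass_upKamekoWord_congr (hμ : l ≤ mu (2 * m + l)) {L L' : List (Fin (l + 1))}
    (hlen : L.length = L'.length) (h : L.toFinset = L'.toFinset) {w : P (l + 1)}
    (hw : w.IsHomogeneous (kamekoDegree l m e)) :
    hitClass (upKamekoWord L w) = hitClass (upKamekoWord L' w) := by
  rcases L.eq_nil_or_concat' with rfl | ⟨_, i, hi⟩
  · rw [List.length_nil, eq_comm, List.length_eq_zero_iff] at hlen
    rw [hlen]
  have hiL : i ∈ L := by simp [hi]
  have hiL' : i ∈ L' := by rwa [← List.mem_toFinset, ← h, List.mem_toFinset]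
  have hdedup := List.toFinset_eq_iff_perm_dedup.1 h
  rw [hitClass_upKamekoWord_eq_dedup hμ hiL hw, hitClass_upKamekoWord_eq_dedup hμ hiL' hw, hlen,
    hdedup.length_eq]
  exact hitClass_upKamekoWord_perm hμ (hdedup.append_left _) hw

end Words

section WeightVectors

variable {k l m e : ℕ}

/-- The variables whose exponent in the monomial with exponents `c` has binary digit `1` at
position `b`. -/
def digitSupport (c : Fin k →₀ ℕ) (b : ℕ) : Finset (Fin k) := {j | (c j).testBit b}

@[simp]
theorem mem_digitSupport {c : Fin k →₀ ℕ} {b : ℕ} {j : Fin k} :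
    j ∈ digitSupport c b ↔ (c j).testBit b := by
  simp [digitSupport]

/-- The entry at position `b` of the weight vector of the monomial with exponents `c`. -/
def weight (c : Fin k →₀ ℕ) (b : ℕ) : ℕ := (digitSupport c b).card

theorem weight_le (c : Fin k →₀ ℕ) (b : ℕ) : weight c b ≤ k :=
  (Finset.card_le_univ _).trans_eq (Fintype.card_fin k)

/-- The exponents divided by two, rounded down. -/
noncomputable def half (c : Fin k →₀ ℕ) : Fin k →₀ ℕ := c.mapRange (· / 2) rfl

theorem half_apply (c : Fin k →₀ ℕ) (j : Fin k) : half c j = c j / 2 := rfl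

theorem weight_half (c : Fin k →₀ ℕ) (b : ℕ) : weight (half c) b = weight c (b + 1) :=
  congrArg Finset.card <| by ext j; simp [half_apply, Nat.testBit_succ]

theorem varProd_eq_monomial (J : Finset (Fin k)) :
    varProd J = monomial (∑ j ∈ J, Finsupp.single j 1) 1 := by
  rw [monomial_sum_one]
  rfl

theorem sum_single_apply (J : Finset (Fin k)) (j : Fin k) :
    (∑ i ∈ J, Finsupp.single i 1 : Fin k →₀ ℕ) j = if j ∈ J then 1 else 0 := by
  rw [Finsupp.finsetSum_apply]
  simp only [Finsupp.single_apply, Finset.sum_ite_eq']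

theorem upKameko_monomial (J : Finset (Fin k)) (c : Fin k →₀ ℕ) :
    upKameko J (monomial c 1) = monomial (∑ j ∈ J, Finsupp.single j 1 + 2 • c) 1 := by
  rw [upKameko_apply, varProd_eq_monomial, monomial_pow, monomial_mul, one_pow, one_mul]

theorem sum_digitSupport_add_two_smul_half (c : Fin k →₀ ℕ) :
    ∑ j ∈ digitSupport c 0, Finsupp.single j 1 + 2 • half c = c := by
  ext j
  rw [Finsupp.add_apply, sum_single_apply, Finsupp.smul_apply, half_apply, smul_eq_mul]
  simp only [mem_digitSupport, Nat.testBit_zero, decide_eq_true_eq]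
  split_ifs <;> omega

theorem monomial_eq_upKameko (c : Fin k →₀ ℕ) :
    (monomial c 1 : P k) = upKameko (digitSupport c 0) (monomial (half c) 1) := by
  rw [upKameko_monomial, sum_digitSupport_add_two_smul_half]

theorem degree_eq_weight_add (c : Fin k →₀ ℕ) : c.degree = weight c 0 + 2 * (half c).degree := by
  conv_lhs => rw [← sum_digitSupport_add_two_smul_half c]
  simp [weight]

theorem degree_half {c : Fin k →₀ ℕ} (hc : c.degree = kamekoDegree l m (e + 1))
    (h : weight c 0 = l) : (half c).degree = kamekoDegree l m e := by
  have := degree_eq_weight_add c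
  rw [kamekoDegree] at hc
  omega

theorem monomial_mem_hit_of_weight_zero_ne (hμ : l ≤ mu (2 * m + l)) (hk : k ≤ l + 1)
    {c : Fin k →₀ ℕ} (hc : c.degree = kamekoDegree l m (e + 1)) (h : weight c 0 ≠ l) :
    (monomial c 1 : P k) ∈ hit k := by
  have hdeg := degree_eq_weight_add c
  have hle := weight_le c 0
  have hlt : weight c 0 < l := by
    rw [kamekoDegree] at hc
    omega
  rw [monomial_eq_upKameko]
  exact upKameko_mem_hit_of_card_lt (e := e) hμ (isHomogeneous_monomial _ rfl) hlt
    (hdeg.symm.trans hc)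

theorem monomial_mem_hit_of_weight_ne (hμ : l ≤ mu (2 * m + l)) (hk : k ≤ l + 1) {b : ℕ}
    (hb : b < e) {c : Fin k →₀ ℕ} (hc : c.degree = kamekoDegree l m e) (h : weight c b ≠ l) :
    (monomial c 1 : P k) ∈ hit k := by
  obtain ⟨e, rfl⟩ := Nat.exists_eq_add_one.2 (Nat.zero_lt_of_lt hb)
  induction b generalizing c e with
  | zero => exact monomial_mem_hit_of_weight_zero_ne hμ hk hc h
  | succ b ih =>
    obtain ⟨e, rfl⟩ := Nat.exists_eq_add_one.2 (show 0 < e by omega)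
    by_cases h₀ : weight c 0 = l
    · have hhalf := degree_half hc h₀
      rw [monomial_eq_upKameko]
      exact upKameko_mem_hit hμ h₀ (ih (by rwa [weight_half]) _ (by omega) hhalf)
        (isHomogeneous_monomial _ hhalf)
    · exact monomial_mem_hit_of_weight_zero_ne hμ hk hc h₀

end WeightVectors

section RegularMonomials

variable {l m e : ℕ}

/-- The `e`-fold iterate of the up Kameko map `w ↦ x_1 ⋯ x_l w²`. -/
noncomputable def upKamekoIter (l e : ℕ) : Module.End (ZMod 2) (P l) := upKameko Finset.univ ^ e

@[simp]
theorem upKamekoIter_zero (w : P l) : upKamekoIter l 0 w = w := rfl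

theorem upKamekoIter_succ (e : ℕ) (w : P l) :
    upKamekoIter l (e + 1) w = upKameko Finset.univ (upKamekoIter l e w) := by
  rw [upKamekoIter, pow_succ', Module.End.mul_apply, upKamekoIter]

theorem upKamekoIter_isHomogeneous (e : ℕ) {w : P l} (hw : w.IsHomogeneous m) :
    (upKamekoIter l e w).IsHomogeneous (kamekoDegree l m e) := by
  induction e with
  | zero => exact hw
  | succ e ih =>
    rw [upKamekoIter_succ]
    exact upKameko_isHomogeneous_succ (Finset.card_fin l) ih

theorem exists_monomial_eq_upKamekoIter {c : Fin l →₀ ℕ} (hc : c.degree = kamekoDegree l m e)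
    (h : ∀ b < e, weight c b = l) :
    ∃ c', c'.degree = m ∧ (monomial c 1 : P l) = upKamekoIter l e (monomial c' 1) := by
  induction e generalizing c with
  | zero => exact ⟨c, hc, rfl⟩
  | succ e ih =>
    have h₀ := h 0 e.succ_pos
    obtain ⟨c', hc', heq⟩ := ih (degree_half hc h₀) fun b hb => by
      rw [weight_half, h _ (Nat.succ_lt_succ hb)]
    have huniv : digitSupport c 0 = Finset.univ := by
      rw [← Finset.card_eq_iff_eq_univ, Fintype.card_fin]
      exact h₀
    exact ⟨c', hc', by rw [monomial_eq_upKameko, huniv, heq, upKamekoIter_succ]⟩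

theorem exists_monomial_eq_upKamekoWord {c : Fin (l + 1) →₀ ℕ}
    (hc : c.degree = kamekoDegree l m e) (h : ∀ b < e, weight c b = l) :
    ∃ L c', L.length = e ∧ c'.degree = m ∧
      (monomial c 1 : P (l + 1)) = upKamekoWord L (monomial c' 1) := by
  induction e generalizing c with
  | zero => exact ⟨[], c, rfl, hc, rfl⟩
  | succ e ih =>
    have h₀ := h 0 e.succ_pos
    obtain ⟨L, c', rfl, hc', heq⟩ := ih (degree_half hc h₀) fun b hb => by
      rw [weight_half, h _ (Nat.succ_lt_succ hb)]
    have hcompl : (digitSupport c 0)ᶜ.card = 1 := by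
      rw [Finset.card_compl, Fintype.card_fin, show (digitSupport c 0).card = l from h₀,
        Nat.add_sub_cancel_left]
    obtain ⟨z, hz⟩ := Finset.card_eq_one.1 hcompl
    have hJ : digitSupport c 0 = Finset.univ.erase z := by
      rw [← Finset.compl_singleton, ← hz, compl_compl]
    exact ⟨z :: L, c', rfl, hc', by rw [monomial_eq_upKameko, hJ, heq, upKamekoWord_cons]⟩

end RegularMonomials

section Projections

variable {l m e : ℕ}

/-- The set of entries of `i` and `I`. -/
def Idx.supp {k : ℕ} (p : Idx k) : Finset (Fin k) := insert p.i p.I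

/-- The substitution `x_i ↦ ∑_{s ∈ I} x_{s - 1}` which is left inverse to `f_i`. -/
noncomputable def proj (p : Idx (l + 1)) : P (l + 1) →ₐ[ZMod 2] P l :=
  aeval (Fin.insertNth (α := fun _ => P l) p.i
    (∑ s ∈ ({s | p.i.succAbove s ∈ p.I} : Finset (Fin l)), X s) fun s => X s)

theorem proj_X_self (p : Idx (l + 1)) :
    proj p (X p.i) = ∑ s ∈ ({s | p.i.succAbove s ∈ p.I} : Finset (Fin l)), X s := by
  rw [proj, aeval_X, Fin.insertNth_apply_same]

theorem proj_X_succAbove (p : Idx (l + 1)) (s : Fin l) : proj p (X (p.i.succAbove s)) = X s := by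
  rw [proj, aeval_X, Fin.insertNth_apply_succAbove]

theorem isLinearSubst_proj (p : Idx (l + 1)) : IsLinearSubst (proj p) := fun j => by
  rcases Fin.eq_self_or_eq_succAbove p.i j with rfl | ⟨s, rfl⟩
  · exact ⟨_, proj_X_self p⟩
  · exact ⟨{s}, by rw [proj_X_succAbove, Finset.sum_singleton]⟩

theorem f_X (i : Fin (l + 1)) (s : Fin l) : f i (X s) = X (i.succAbove s) := rename_X _ _

theorem isLinearSubst_f (i : Fin (l + 1)) : IsLinearSubst (f i) := fun s =>
  ⟨{i.succAbove s}, by rw [f_X, Finset.sum_singleton]⟩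

theorem proj_f (p : Idx (l + 1)) (y : P l) : proj p (f p.i y) = y := by
  have h : (proj p).comp (f p.i) = AlgHom.id _ _ := by
    ext1 s
    rw [AlgHom.comp_apply, f_X, proj_X_succAbove, AlgHom.id_apply]
  exact DFunLike.congr_fun h y

theorem f_varProd (i : Fin (l + 1)) (J : Finset (Fin l)) :
    f i (varProd J) = varProd (J.map i.succAboveEmb) := by
  rw [varProd, varProd, map_prod, Finset.prod_map]
  exact Finset.prod_congr rfl fun s _ => f_X i s

theorem map_succAboveEmb_univ (i : Fin (l + 1)) :
    Finset.univ.map i.succAboveEmb = Finset.univ.erase i := by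
  ext j
  simp [Fin.exists_succAbove_eq_iff]

theorem X_mul_f_varProd_erase (i : Fin (l + 1)) (s : Fin l) :
    X i * f i (varProd (Finset.univ.erase s)) =
      varProd (Finset.univ.erase (i.succAbove s)) := by
  rw [f_varProd, Finset.map_erase, map_succAboveEmb_univ, Finset.erase_right_comm]
  exact X_mul_varProd_erase (by simp)

theorem proj_upKamekoOmit_self (p : Idx (l + 1)) (w : P (l + 1)) :
    proj p (upKamekoOmit p.i w) = upKameko Finset.univ (proj p w) := by
  rw [upKameko_apply, upKameko_apply, map_mul, map_pow, ← map_succAboveEmb_univ, ← f_varProd,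
    proj_f]

theorem proj_upKamekoOmit_succAbove (p : Idx (l + 1)) (s : Fin l) (w : P (l + 1)) :
    proj p (upKamekoOmit (p.i.succAbove s) w) =
      ∑ t ∈ ({t | p.i.succAbove t ∈ p.I} : Finset (Fin l)),
        X t * upKameko (Finset.univ.erase s) (proj p w) := by
  rw [upKameko_apply, map_mul, map_pow, ← X_mul_f_varProd_erase, map_mul, proj_X_self, proj_f,
    mul_assoc, ← upKameko_apply, Finset.sum_mul]

theorem hitClass_proj_upKamekoOmit (hμ : l ≤ mu (2 * m + l)) (p : Idx (l + 1))
    (z : Fin (l + 1)) {w : P (l + 1)} (hw : w.IsHomogeneous (kamekoDegree l m e)) :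
    hitClass (proj p (upKamekoOmit z w)) =
      if z ∈ p.supp then hitClass (upKameko Finset.univ (proj p w)) else 0 := by
  rcases Fin.eq_self_or_eq_succAbove p.i z with rfl | ⟨s, rfl⟩
  · have hi : p.i ∈ p.supp := Finset.mem_insert_self p.i p.I
    rw [proj_upKamekoOmit_self, if_pos hi]
  · have hterm (t : Fin l) : hitClass (X t * upKameko (Finset.univ.erase s) (proj p w)) =
        if s = t then hitClass (upKameko Finset.univ (proj p w)) else 0 := by
      split_ifs with hst
      · rw [← hst, X_mul_upKameko_erase (Finset.mem_univ s)]
      · have hcard := Finset.card_erase_add_one (Finset.mem_univ s)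
        rw [Finset.card_fin] at hcard
        exact hitClass_eq_zero.2 (X_mul_upKameko_mem_hit hμ hcard (by simp [Ne.symm hst])
          ((isLinearSubst_proj p).isHomogeneous_map hw))
    rw [proj_upKamekoOmit_succAbove, map_sum, Finset.sum_congr rfl fun t _ => hterm t,
      Finset.sum_ite_eq]
    simp [Idx.supp]

theorem hitClass_proj_upKamekoWord (hμ : l ≤ mu (2 * m + l)) (p : Idx (l + 1))
    (L : List (Fin (l + 1))) {w : P (l + 1)} (hw : w.IsHomogeneous m) :
    hitClass (proj p (upKamekoWord L w)) =
      if L.toFinset ⊆ p.supp then hitClass (upKamekoIter l L.length (proj p w)) else 0 := by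
  have hproj := (isLinearSubst_proj p).isHomogeneous_map hw
  induction L with
  | nil => simp
  | cons z L ih =>
    have hL := upKamekoWord_isHomogeneous (l := l) (m := m) (e := 0) L hw
    have hprojL := (isLinearSubst_proj p).isHomogeneous_map hL
    rw [zero_add] at hprojL
    rw [upKamekoWord_cons, hitClass_proj_upKamekoOmit hμ p z hL, List.toFinset_cons,
      List.length_cons, upKamekoIter_succ]
    simp only [Finset.insert_subset_iff]
    by_cases hz : z ∈ p.supp
    · simp only [hz, if_true, true_and]
      split_ifs with h
      · rw [if_pos h] at ih
        exact hitClass_upKameko_congr hμ (Finset.card_fin l) ih hprojL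
          (upKamekoIter_isHomogeneous _ hproj)
      · rw [if_neg h, hitClass_eq_zero] at ih
        exact hitClass_eq_zero.2 (upKameko_mem_hit hμ (Finset.card_fin l) ih hprojL)
    · simp [hz]

end Projections

section DownKameko

variable {k l m e : ℕ}

/-- Kameko's map, `x_1 ⋯ x_k w² ↦ w`, which vanishes on the monomials not of this form. -/
noncomputable def downKameko (k : ℕ) : P k →ₗ[ZMod 2] P k :=
  (basisMonomials (Fin k) (ZMod 2)).constr (ZMod 2) fun c =>
    if digitSupport c 0 = Finset.univ then monomial (half c) 1 else 0

theorem downKameko_monomial (c : Fin k →₀ ℕ) : downKameko k (monomial c 1) =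
    if digitSupport c 0 = Finset.univ then monomial (half c) 1 else 0 := by
  rw [downKameko, ← congrFun (coe_basisMonomials (Fin k) (ZMod 2)) c, Module.Basis.constr_basis]

theorem digitSupport_sum_add_two_smul (J : Finset (Fin k)) (c : Fin k →₀ ℕ) :
    digitSupport (∑ j ∈ J, Finsupp.single j 1 + 2 • c) 0 = J := by
  ext j
  rw [mem_digitSupport, Finsupp.add_apply, sum_single_apply, Finsupp.smul_apply]
  split_ifs with h <;> simp [h]

theorem half_sum_add_two_smul (J : Finset (Fin k)) (c : Fin k →₀ ℕ) :
    half (∑ j ∈ J, Finsupp.single j 1 + 2 • c) = c := by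
  ext j
  rw [half_apply, Finsupp.add_apply, sum_single_apply, Finsupp.smul_apply, smul_eq_mul]
  split_ifs <;> omega

theorem downKameko_upKameko (J : Finset (Fin k)) (v : P k) :
    downKameko k (upKameko J v) = if J = Finset.univ then v else 0 := by
  have h : downKameko k ∘ₗ upKameko J = if J = Finset.univ then LinearMap.id else 0 := by
    refine (basisMonomials (Fin k) (ZMod 2)).ext fun c => ?_
    rw [coe_basisMonomials, LinearMap.comp_apply, upKameko_monomial, downKameko_monomial,
      digitSupport_sum_add_two_smul, half_sum_add_two_smul]
    split_ifs <;> rfl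
  rw [← LinearMap.comp_apply, h]
  split_ifs <;> rfl

theorem downKameko_mem_hit {w : P k} (hw : w ∈ hit k) : downKameko k w ∈ hit k := by
  refine hit_le (V := (hit k).comap (downKameko k)) (fun i v hi => ?_) hw
  refine mem_of_forall_monomial_mem (V := ((hit k).comap (downKameko k)).comap (Sq k i))
    fun c _ => ?_
  rw [Submodule.mem_comap, Submodule.mem_comap, monomial_eq_upKameko, Sq_upKameko, map_sum]
  refine Submodule.sum_mem _ fun C hC => ?_
  rw [downKameko_upKameko]
  split_ifs with huniv
  · obtain rfl : C = ∅ := Finset.disjoint_self_iff_empty C |>.1 <|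
      Finset.sdiff_disjoint.symm.mono_right (huniv ▸ Finset.subset_univ C)
    simp only [Finset.mem_filter, Finset.card_empty, Nat.sub_zero] at hC ⊢
    obtain ⟨-, -, b, rfl⟩ := hC
    rw [varProd, Finset.prod_empty, one_mul]
    exact Sq_mem_hit (by omega) _
  · exact zero_mem _

theorem mem_hit_of_upKamekoIter_mem_hit {w : P l} (hw : upKamekoIter l e w ∈ hit l) :
    w ∈ hit l := by
  induction e with
  | zero => exact hw
  | succ e ih =>
    have h := downKameko_mem_hit hw
    rw [upKamekoIter_succ, downKameko_upKameko, if_pos rfl] at h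
    exact ih h

end DownKameko

section Irregular

variable {l m e : ℕ}

/-- The span of the monomials of `P_l` of degree `kamekoDegree l m e` whose weight vector has an
entry different from `l` at one of the first `e` positions. -/
noncomputable def irregular (l m e : ℕ) : Submodule (ZMod 2) (P l) :=
  Submodule.span (ZMod 2) {x | ∃ c : Fin l →₀ ℕ,
    c.degree = kamekoDegree l m e ∧ (∃ b < e, weight c b ≠ l) ∧ x = monomial c 1}

theorem irregular_le_hit (hμ : l ≤ mu (2 * m + l)) (e : ℕ) : irregular l m e ≤ hit l := by
  refine Submodule.span_le.2 ?_
  rintro _ ⟨c, hc, ⟨b, hb, hcol⟩, rfl⟩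
  exact monomial_mem_hit_of_weight_ne hμ (Nat.le_succ l) hb hc hcol

theorem exists_upKamekoIter_sub_mem_irregular {w : P l}
    (hw : w.IsHomogeneous (kamekoDegree l m e)) :
    ∃ y : P l, y.IsHomogeneous m ∧ w - upKamekoIter l e y ∈ irregular l m e := by
  have h : w ∈ (homogeneousSubmodule (Fin l) (ZMod 2) m).map (upKamekoIter l e) ⊔
      irregular l m e := by
    refine mem_of_isHomogeneous (fun c hc => ?_) hw
    by_cases h : ∃ b < e, weight c b ≠ l
    · exact Submodule.mem_sup_right (Submodule.subset_span ⟨c, hc, h, rfl⟩)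
    · push Not at h
      obtain ⟨c', hc', heq⟩ := exists_monomial_eq_upKamekoIter hc h
      exact Submodule.mem_sup_left ⟨_, isHomogeneous_monomial _ hc', heq.symm⟩
  obtain ⟨_, ⟨y, hy, rfl⟩, z, hz, rfl⟩ := Submodule.mem_sup.1 h
  exact ⟨y, hy, by rwa [add_sub_cancel_left]⟩

end Irregular

section BinaryDigits

variable {k : ℕ}

theorem testBit_sum_two_pow (s : Finset ℕ) (b : ℕ) : (∑ i ∈ s, 2 ^ i).testBit b ↔ b ∈ s := by
  rw [← Nat.mem_bitIndices, ← List.mem_toFinset, Finset.toFinset_bitIndices_sum_two_pow]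

theorem le_and_testBit_sub {x y : ℕ} (h : ∀ b, y.testBit b → x.testBit b) :
    y ≤ x ∧ ∀ b, (x - y).testBit b ↔ x.testBit b ∧ ¬ y.testBit b := by
  have hsub : y.bitIndices.toFinset ⊆ x.bitIndices.toFinset := fun b => by simpa using h b
  have hsum := Finset.sum_sdiff (f := (2 ^ ·)) hsub
  rw [Finset.sum_toFinset_bitIndices_two_pow, Finset.sum_toFinset_bitIndices_two_pow] at hsum
  refine ⟨hsum ▸ Nat.le_add_left _ _, fun b => ?_⟩
  rw [Nat.sub_eq_of_eq_add hsum.symm, testBit_sum_two_pow]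
  simp

theorem le_of_digitSupport_subset {c d : Fin k →₀ ℕ}
    (h : ∀ b, digitSupport d b ⊆ digitSupport c b) : d ≤ c := fun _ =>
  (le_and_testBit_sub fun b hb => mem_digitSupport.1 (h b (mem_digitSupport.2 hb))).1

theorem weight_sub {c d : Fin k →₀ ℕ} (h : ∀ b, digitSupport d b ⊆ digitSupport c b) (b : ℕ) :
    weight (c - d) b = weight c b - weight d b := by
  rw [weight, weight, weight, ← Finset.card_sdiff_of_subset (h b)]
  congr 1
  ext j
  simpa using
    (le_and_testBit_sub fun b hb => mem_digitSupport.1 (h b (mem_digitSupport.2 hb))).2 b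

theorem digitSupport_sum_single (g : ℕ → Fin k) (r b : ℕ) :
    digitSupport (∑ a ∈ Finset.range r, Finsupp.single (g a) (2 ^ a)) b =
      if b < r then {g b} else ∅ := by
  have happly (j : Fin k) : (∑ a ∈ Finset.range r, Finsupp.single (g a) (2 ^ a)) j =
      ∑ a ∈ Finset.range r with g a = j, 2 ^ a := by
    simp only [Finsupp.finsetSum_apply, Finsupp.single_apply, Finset.sum_filter]
  ext j
  rw [mem_digitSupport, happly, testBit_sum_two_pow, Finset.mem_filter, Finset.mem_range]
  split_ifs with h <;> simp [h, eq_comm]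

end BinaryDigits

section Phi

variable {l m e : ℕ} {p : Idx (l + 1)} {a : Fin l →₀ ℕ} {u : Fin p.r}

theorem phi_monomial (p : Idx (l + 1)) (a : Fin l →₀ ℕ) :
    phi p (monomial a 1) = phiMonomial p a := by
  rw [phi, ← congrFun (coe_basisMonomials (Fin l) (ZMod 2)) a, Module.Basis.constr_basis]

theorem phi_of_empty (hp : p.I = ∅) (w : P l) : phi p w = f p.i w := by
  have h : phi p = (f p.i).toLinearMap := (basisMonomials (Fin l) (ZMod 2)).ext fun a => by
    rw [coe_basisMonomials, phi_monomial, phiMonomial, if_pos hp, AlgHom.toLinearMap_apply]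
  rw [h, AlgHom.toLinearMap_apply]

theorem phi_monomial_of_compatible (hp : p.I ≠ ∅) (hu : Compatible p a u) :
    phi p (monomial a 1) =
      (X p.i ^ (2 ^ p.r - 1) * f p.i (monomial a 1)).divMonomial (divisorExp p u) := by
  have h : ∃ u, Compatible p a u := ⟨u, hu⟩
  rw [phi_monomial, phiMonomial, if_neg hp, dif_pos h, h.choose_spec.unique hu]

theorem phi_monomial_of_not_compatible (hp : p.I ≠ ∅) (h : ¬ ∃ u, Compatible p a u) :
    phi p (monomial a 1) = 0 := by
  rw [phi_monomial, phiMonomial, if_neg hp, dif_neg h]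

theorem entry_mem (p : Idx (l + 1)) (t : Fin p.r) : p.entry t ∈ p.I :=
  Finset.orderEmbOfFin_mem p.I rfl t

theorem succAbove_entryPred (p : Idx (l + 1)) (t : Fin p.r) :
    p.i.succAbove (p.entryPred t) = p.entry t :=
  Fin.succAbove_pred_of_lt _ _ (p.lt _ (entry_mem p t))

/-- The variable whose exponent in `x_i^{2^r-1} f_i(x) / x_{(I,u)}` lacks the binary digit at
position `b`. For `b < r` the division by `x_{(I,u)}` removes this digit, and for `b ≥ r` the
variable is `x_i`, which has the exponent `2^r - 1`. -/
def letter (p : Idx (l + 1)) (u : Fin p.r) (b : ℕ) : Fin (l + 1) :=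
  if h : b < p.r then p.entry (max u (Fin.rev ⟨b, h⟩)) else p.i

theorem letter_of_lt {b : ℕ} (u : Fin p.r) (hb : b < p.r) :
    letter p u b = p.entry (max u (Fin.rev ⟨b, hb⟩)) := dif_pos hb

theorem letter_of_le {b : ℕ} (u : Fin p.r) (hb : p.r ≤ b) : letter p u b = p.i :=
  dif_neg hb.not_gt

theorem divisorExp_eq (p : Idx (l + 1)) (u : Fin p.r) :
    divisorExp p u = ∑ b ∈ Finset.range p.r, Finsupp.single (letter p u b) (2 ^ b) := by
  have hterm (t : Fin p.r) : Finsupp.single (letter p u t.rev) (2 ^ (t.rev : ℕ)) =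
      Finsupp.single (p.entry (max u t)) (2 ^ (p.r - 1 - (t : ℕ))) := by
    rw [letter_of_lt u t.rev.2, Fin.eta, Fin.rev_rev, Fin.val_rev, Nat.sub_sub, add_comm 1]
  rw [Finset.sum_range, ← Equiv.sum_comp Fin.revPerm]
  simp only [Fin.revPerm_apply, hterm]
  rw [← Finset.sum_filter_add_sum_filter_not Finset.univ (· ≤ u), divisorExp,
    Finsupp.single_finsetSum]
  simp only [not_le, Finset.filter_ge_eq_Iic, Finset.filter_lt_eq_Ioi]
  congr 1
  · exact Finset.sum_congr rfl fun t ht => by rw [max_eq_left (Finset.mem_Iic.1 ht)]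
  · exact Finset.sum_congr rfl fun t ht => by rw [max_eq_right (Finset.mem_Ioi.1 ht).le]

theorem degree_divisorExp (p : Idx (l + 1)) (u : Fin p.r) :
    (divisorExp p u).degree = 2 ^ p.r - 1 := by
  rw [divisorExp_eq, map_sum]
  simp only [Finsupp.degree_single]
  rw [Nat.geomSum_eq le_rfl, Nat.div_one]

/-- The exponents of `x_i^{2^r - 1} f_i(x)`. -/
noncomputable def numeratorExp (p : Idx (l + 1)) (a : Fin l →₀ ℕ) : Fin (l + 1) →₀ ℕ :=
  Finsupp.single p.i (2 ^ p.r - 1) + a.mapDomain p.i.succAbove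

theorem X_pow_mul_f_monomial (p : Idx (l + 1)) (a : Fin l →₀ ℕ) :
    (X p.i ^ (2 ^ p.r - 1) * f p.i (monomial a 1) : P (l + 1)) = monomial (numeratorExp p a) 1 := by
  rw [f, rename_monomial, X_pow_eq_monomial, monomial_mul, one_mul, numeratorExp]

theorem degree_numeratorExp (p : Idx (l + 1)) (a : Fin l →₀ ℕ) :
    (numeratorExp p a).degree = 2 ^ p.r - 1 + a.degree := by
  rw [numeratorExp, map_add, Finsupp.degree_single, Finsupp.degree_mapDomain]

theorem numeratorExp_self (p : Idx (l + 1)) (a : Fin l →₀ ℕ) :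
    numeratorExp p a p.i = 2 ^ p.r - 1 := by
  rw [numeratorExp, Finsupp.add_apply, Finsupp.single_eq_same,
    Finsupp.mapDomain_of_notMem_range _ _ (by simp), add_zero]

theorem numeratorExp_succAbove (p : Idx (l + 1)) (a : Fin l →₀ ℕ) (s : Fin l) :
    numeratorExp p a (p.i.succAbove s) = a s := by
  rw [numeratorExp, Finsupp.add_apply, Finsupp.single_eq_of_ne (Fin.succAbove_ne _ _),
    Finsupp.mapDomain_apply Fin.succAbove_right_injective, zero_add]

theorem weight_numeratorExp (p : Idx (l + 1)) (a : Fin l →₀ ℕ) (b : ℕ) :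
    weight (numeratorExp p a) b = (if b < p.r then 1 else 0) + weight a b := by
  simp only [weight, digitSupport, Finset.card_filter]
  rw [Fin.sum_univ_succAbove _ p.i]
  simp only [numeratorExp_self, numeratorExp_succAbove, Nat.testBit_two_pow_sub_one,
    decide_eq_true_eq]

theorem Compatible.testBit_letter (hu : Compatible p a u) {b : ℕ} (hb : b < p.r) :
    (numeratorExp p a (letter p u b)).testBit b := by
  have hrev : p.r - 1 - ((Fin.rev ⟨b, hb⟩ : Fin p.r) : ℕ) = b := by
    simp only [Fin.val_rev]
    omega
  rw [letter_of_lt u hb, ← succAbove_entryPred, numeratorExp_succAbove]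
  rcases le_or_gt (Fin.rev ⟨b, hb⟩) u with h | h
  · simpa only [max_eq_left h, hrev] using hu.digit_at _ h
  · simpa only [max_eq_right h.le, hrev] using hu.digit_of_gt _ h

theorem digitSupport_divisorExp (p : Idx (l + 1)) (u : Fin p.r) (b : ℕ) :
    digitSupport (divisorExp p u) b = if b < p.r then {letter p u b} else ∅ := by
  rw [divisorExp_eq, digitSupport_sum_single]

theorem Compatible.digitSupport_divisorExp_subset (hu : Compatible p a u) (b : ℕ) :
    digitSupport (divisorExp p u) b ⊆ digitSupport (numeratorExp p a) b := by
  rw [digitSupport_divisorExp]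
  split_ifs with hb
  · exact Finset.singleton_subset_iff.2 (mem_digitSupport.2 (hu.testBit_letter hb))
  · exact Finset.empty_subset _

theorem weight_numeratorExp_sub_divisorExp (hu : Compatible p a u) (b : ℕ) :
    weight (numeratorExp p a - divisorExp p u) b = weight a b := by
  have hdivisor : weight (divisorExp p u) b = if b < p.r then 1 else 0 := by
    rw [weight, digitSupport_divisorExp]
    split_ifs <;> rfl
  rw [weight_sub hu.digitSupport_divisorExp_subset, weight_numeratorExp, hdivisor,
    Nat.add_sub_cancel_left]

theorem phi_monomial_eq_monomial (hp : p.I ≠ ∅) (hu : Compatible p a u) :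
    phi p (monomial a 1) = monomial (numeratorExp p a - divisorExp p u) 1 := by
  rw [phi_monomial_of_compatible hp hu, X_pow_mul_f_monomial]
  nth_rw 1 [← tsub_add_cancel_of_le (le_of_digitSupport_subset hu.digitSupport_divisorExp_subset),
    ← one_mul (1 : ZMod 2), ← monomial_mul, divMonomial_mul_monomial]

theorem degree_numeratorExp_sub_divisorExp (hu : Compatible p a u) :
    (numeratorExp p a - divisorExp p u).degree = a.degree := by
  have h := congrArg Finsupp.degree
    (tsub_add_cancel_of_le (le_of_digitSupport_subset hu.digitSupport_divisorExp_subset))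
  rw [map_add, degree_divisorExp, degree_numeratorExp, add_comm] at h
  exact Nat.add_left_cancel h

theorem phi_monomial_eq_zero_or (p : Idx (l + 1)) (a : Fin l →₀ ℕ) :
    phi p (monomial a 1) = 0 ∨ ∃ c, phi p (monomial a 1) = monomial c 1 ∧
      c.degree = a.degree ∧ ∀ b, weight c b = weight a b := by
  by_cases hp : p.I = ∅
  · have hr : p.r = 0 := Finset.card_eq_zero.2 hp
    refine .inr ⟨numeratorExp p a, ?_, ?_, fun b => ?_⟩
    · simp [phi_of_empty hp, ← X_pow_mul_f_monomial, hr]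
    · simp [degree_numeratorExp, hr]
    · simp [weight_numeratorExp, hr]
  · by_cases h : ∃ u, Compatible p a u
    · obtain ⟨u, hu⟩ := h
      exact .inr ⟨_, phi_monomial_eq_monomial hp hu, degree_numeratorExp_sub_divisorExp hu,
        weight_numeratorExp_sub_divisorExp hu⟩
    · exact .inl (phi_monomial_of_not_compatible hp h)

theorem phi_isHomogeneous (p : Idx (l + 1)) {n : ℕ} {w : P l} (hw : w.IsHomogeneous n) :
    (phi p w).IsHomogeneous n := by
  refine mem_of_isHomogeneous
    (V := (homogeneousSubmodule (Fin (l + 1)) (ZMod 2) n).comap (phi p)) (fun a ha => ?_) hw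
  rw [Submodule.mem_comap]
  rcases phi_monomial_eq_zero_or p a with h | ⟨c, h, hc, -⟩
  · exact h ▸ zero_mem _
  · exact h ▸ isHomogeneous_monomial _ (hc.trans ha)

theorem phi_mem_hit_of_mem_irregular (hμ : l ≤ mu (2 * m + l)) (p : Idx (l + 1)) {w : P l}
    (hw : w ∈ irregular l m e) : phi p w ∈ hit (l + 1) := by
  refine Submodule.span_le (p := (hit (l + 1)).comap (phi p)) |>.2 ?_ hw
  rintro _ ⟨a, ha, ⟨b, hb, hweight⟩, rfl⟩
  rw [SetLike.mem_coe, Submodule.mem_comap]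
  rcases phi_monomial_eq_zero_or p a with h | ⟨c, h, hc, hcw⟩
  · exact h ▸ zero_mem _
  · exact h ▸ monomial_mem_hit_of_weight_ne hμ le_rfl hb (hc.trans ha) (by rwa [hcw])

end Phi

section WordsOfPhi

variable {l : ℕ} {p : Idx (l + 1)}

theorem upKamekoIter_eq (d : ℕ) (y : P l) :
    upKamekoIter l d y = varProd Finset.univ ^ (2 ^ d - 1) * y ^ 2 ^ d := by
  induction d with
  | zero => simp
  | succ d ih =>
    rw [upKamekoIter_succ, upKameko_apply, ih, two_pow_succ_sub_one, pow_succ 2 d]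
    ring

theorem upKamekoWord_map_range_mul_prod (d : ℕ) (g : ℕ → Fin (l + 1)) (y : P (l + 1)) :
    upKamekoWord ((List.range d).map g) y * ∏ b ∈ Finset.range d, X (g b) ^ 2 ^ b =
      varProd Finset.univ ^ (2 ^ d - 1) * y ^ 2 ^ d := by
  induction d generalizing g with
  | zero => simp
  | succ d ih =>
    have hprod : ∏ b ∈ Finset.range (d + 1), (X (g b) : P (l + 1)) ^ 2 ^ b =
        (∏ b ∈ Finset.range d, X (g (b + 1)) ^ 2 ^ b) ^ 2 * X (g 0) := by
      simp only [Finset.prod_range_succ', ← Finset.prod_pow, ← pow_mul, ← pow_succ, pow_zero,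
        pow_one]
    have ih := ih (g ∘ (· + 1))
    simp only [Function.comp_apply] at ih
    rw [List.range_succ_eq_map, List.map_cons, List.map_map, upKamekoWord_cons, upKameko_apply,
      hprod, two_pow_succ_sub_one, pow_succ 2 d]
    calc _ = X (g 0) * varProd (Finset.univ.erase (g 0)) *
          (upKamekoWord ((List.range d).map (g ∘ (· + 1))) y *
            ∏ b ∈ Finset.range d, X (g (b + 1)) ^ 2 ^ b) ^ 2 := by ring
      _ = _ := by
        rw [X_mul_varProd_erase (Finset.mem_univ _), ih]
        ring

/-- The exponents of the `d`-fold up Kameko image of the monomial with exponents `b`. -/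
noncomputable def upKamekoExp (d : ℕ) (b : Fin l →₀ ℕ) : Fin l →₀ ℕ :=
  ∑ j, Finsupp.single j (2 ^ d - 1) + 2 ^ d • b

theorem upKamekoExp_apply (d : ℕ) (b : Fin l →₀ ℕ) (j : Fin l) :
    upKamekoExp d b j = 2 ^ d * b j + (2 ^ d - 1) := by
  rw [upKamekoExp, Finsupp.add_apply, Finsupp.finsetSum_apply, Finsupp.smul_apply, smul_eq_mul,
    add_comm]
  simp only [Finsupp.single_apply, Finset.sum_ite_eq', Finset.mem_univ, if_true]

theorem upKamekoIter_monomial (d : ℕ) (b : Fin l →₀ ℕ) :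
    upKamekoIter l d (monomial b 1) = monomial (upKamekoExp d b) 1 := by
  rw [upKamekoIter_eq, varProd_eq_monomial, monomial_pow, monomial_pow, one_pow, one_pow,
    monomial_mul, one_mul, Finset.smul_sum, upKamekoExp]
  simp

theorem testBit_upKamekoExp {d c : ℕ} (hc : c < d) (b : Fin l →₀ ℕ) (j : Fin l) :
    (upKamekoExp d b j).testBit c := by
  rw [upKamekoExp_apply, Nat.testBit_two_pow_mul_add _ (Nat.sub_one_lt (by positivity)),
    if_pos hc, Nat.testBit_two_pow_sub_one, decide_eq_true hc]

theorem compatible_upKamekoExp {d : ℕ} (hd : p.r ≤ d) {b : Fin l →₀ ℕ} {u : Fin p.r}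
    (hlt : ∀ t < u, p.r = d ∧ b (p.entryPred t) = 0)
    (hu : p.r < d ∨ b (p.entryPred u) ≠ 0) : Compatible p (upKamekoExp d b) u := by
  have hpow := Nat.one_le_two_pow (n := d)
  have hpow' := Nat.one_le_two_pow (n := p.r)
  refine ⟨fun t ht => ?_, ?_, fun t _ => testBit_upKamekoExp (by omega) _ _,
    fun t _ => testBit_upKamekoExp (by omega) _ _⟩
  · rw [upKamekoExp_apply, (hlt t ht).1, (hlt t ht).2, mul_zero, zero_add]
  · rw [upKamekoExp_apply]
    rcases hu with h | h
    · have := Nat.pow_lt_pow_right one_lt_two h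
      omega
    · have h₁ : 2 ^ d ≤ 2 ^ d * b (p.entryPred u) :=
        Nat.le_mul_of_pos_right _ (Nat.pos_of_ne_zero h)
      have h₂ : 2 ^ p.r ≤ 2 ^ d := Nat.pow_le_pow_right two_pos hd
      omega

/-- The word that describes `φ_{(i;I)}` on `u`-compatible `d`-fold up Kameko images. -/
def phiWord (d : ℕ) (p : Idx (l + 1)) (u : Fin p.r) : List (Fin (l + 1)) :=
  (List.range d).map (letter p u)

theorem length_phiWord (d : ℕ) (p : Idx (l + 1)) (u : Fin p.r) : (phiWord d p u).length = d := by
  simp [phiWord]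

theorem phi_upKamekoIter_monomial {d : ℕ} (hp : p.I ≠ ∅) (hd : p.r ≤ d) {b : Fin l →₀ ℕ}
    {u : Fin p.r} (hu : Compatible p (upKamekoExp d b) u) :
    phi p (upKamekoIter l d (monomial b 1)) =
      upKamekoWord (phiWord d p u) (f p.i (monomial b 1)) := by
  have hdivisor : (monomial (divisorExp p u) 1 : P (l + 1)) =
      ∏ c ∈ Finset.range p.r, X (letter p u c) ^ 2 ^ c := by
    simp only [divisorExp_eq, monomial_sum_one, X_pow_eq_monomial]
  have hX : (X p.i : P (l + 1)) ^ (2 ^ p.r - 1) *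
      ∏ c ∈ Finset.Ico p.r d, X (letter p u c) ^ 2 ^ c = X p.i ^ (2 ^ d - 1) := by
    have hpow (t : ℕ) : (X p.i : P (l + 1)) ^ (2 ^ t - 1) =
        ∏ c ∈ Finset.range t, X p.i ^ 2 ^ c := by
      rw [Finset.prod_pow_eq_pow_sum, Nat.geomSum_eq le_rfl, Nat.div_one]
    rw [hpow, hpow, ← Finset.prod_range_mul_prod_Ico _ hd]
    congr 1
    exact Finset.prod_congr rfl fun c hc => by rw [letter_of_le _ (Finset.mem_Ico.1 hc).1]
  rw [upKamekoIter_monomial, phi_monomial_of_compatible hp hu, ← upKamekoIter_monomial]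
  suffices h : X p.i ^ (2 ^ p.r - 1) * f p.i (upKamekoIter l d (monomial b 1)) =
      upKamekoWord (phiWord d p u) (f p.i (monomial b 1)) * monomial (divisorExp p u) 1 by
    rw [h, divMonomial_mul_monomial]
  have hne : ∏ c ∈ Finset.Ico p.r d, (X (letter p u c) : P (l + 1)) ^ 2 ^ c ≠ 0 :=
    Finset.prod_ne_zero_iff.2 fun _ _ => pow_ne_zero _ (X_ne_zero _)
  refine mul_right_cancel₀ hne ?_
  rw [mul_assoc (upKamekoWord _ _), hdivisor, Finset.prod_range_mul_prod_Ico _ hd, phiWord,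
    upKamekoWord_map_range_mul_prod, mul_right_comm, hX, upKamekoIter_eq, map_mul, map_pow,
    map_pow, f_varProd, map_succAboveEmb_univ, ← mul_assoc, ← mul_pow,
    X_mul_varProd_erase (Finset.mem_univ _)]

end WordsOfPhi

section ShortIndices

variable {l : ℕ} {p : Idx (l + 1)}

theorem f_upKamekoIter (i : Fin (l + 1)) (d : ℕ) (y : P l) :
    f i (upKamekoIter l d y) = upKamekoWord (List.replicate d i) (f i y) := by
  induction d with
  | zero => rfl
  | succ d ih =>
    rw [List.replicate_succ, upKamekoWord_cons, ← ih, upKamekoIter_succ, upKameko_apply,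
      upKameko_apply, map_mul, map_pow, f_varProd, map_succAboveEmb_univ]

theorem exists_entry_eq {j : Fin (l + 1)} (hj : j ∈ p.I) : ∃ t, p.entry t = j := by
  rwa [← Finset.mem_coe, ← Finset.range_orderEmbOfFin p.I rfl] at hj

theorem toFinset_phiWord_zero {d : ℕ} (hr : 0 < p.r) (hd : p.r < d) :
    (phiWord d p ⟨0, hr⟩).toFinset = p.supp := by
  have hletter {b : ℕ} (hb : b < p.r) :
      letter p ⟨0, hr⟩ b = p.entry (Fin.rev ⟨b, hb⟩) := by
    rw [letter_of_lt _ hb, max_eq_right (Fin.mk_le_of_le_val (Nat.zero_le _))]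
  ext j
  simp only [phiWord, List.mem_toFinset, List.mem_map, List.mem_range, Idx.supp,
    Finset.mem_insert]
  constructor
  · rintro ⟨b, -, rfl⟩
    rcases lt_or_ge b p.r with hb | hb
    · exact .inr (hletter hb ▸ entry_mem p _)
    · exact .inl (letter_of_le _ hb)
  · rintro (rfl | hj)
    · exact ⟨p.r, hd, letter_of_le _ le_rfl⟩
    · obtain ⟨t, rfl⟩ := exists_entry_eq hj
      exact ⟨t.rev, t.rev.2.trans hd, by rw [hletter t.rev.2, Fin.eta, Fin.rev_rev]⟩

theorem exists_word_of_r_lt {d : ℕ} (hd : p.r < d) :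
    ∃ L : List (Fin (l + 1)), L.length = d ∧ L.toFinset = p.supp ∧
      ∀ y, phi p (upKamekoIter l d y) = upKamekoWord L (f p.i y) := by
  by_cases hp : p.I = ∅
  · refine ⟨List.replicate d p.i, List.length_replicate, ?_, fun y => ?_⟩
    · rw [List.toFinset_replicate_of_ne_zero (Nat.ne_zero_of_lt hd), Idx.supp, hp,
        insert_empty_eq]
    · rw [phi_of_empty hp, f_upKamekoIter]
  · have hr : 0 < p.r := Finset.card_pos.2 (Finset.nonempty_iff_ne_empty.2 hp)
    have hcompatible (b : Fin l →₀ ℕ) : Compatible p (upKamekoExp d b) ⟨0, hr⟩ :=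
      compatible_upKamekoExp hd.le (fun t ht => absurd ht (by simp [Fin.lt_def])) (.inl hd)
    have hphi : phi p ∘ₗ upKamekoIter l d =
        upKamekoWord (phiWord d p ⟨0, hr⟩) ∘ₗ (f p.i).toLinearMap :=
      (basisMonomials (Fin l) (ZMod 2)).ext fun b => by
        simpa using phi_upKamekoIter_monomial hp hd.le (hcompatible b)
    exact ⟨_, length_phiWord _ _ _, toFinset_phiWord_zero hr hd, DFunLike.congr_fun hphi⟩

end ShortIndices

section LongestIndex

variable {l : ℕ} {p : Idx (l + 1)}

theorem Idx.I_subset (p : Idx (l + 1)) : p.I ⊆ Finset.univ.erase p.i := fun j hj =>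
  Finset.mem_erase.2 ⟨(p.lt j hj).ne', Finset.mem_univ j⟩

theorem Idx.r_le (p : Idx (l + 1)) : p.r ≤ l :=
  (Finset.card_le_card p.I_subset).trans_eq (card_univ_erase p.i)

theorem Idx.I_eq_of_r_eq (hp : p.r = l) : p.I = Finset.univ.erase 0 := by
  have hI := Finset.eq_of_subset_of_card_le p.I_subset (by rw [card_univ_erase]; exact hp.ge)
  have hi : p.i = 0 := by
    by_contra hne
    refine Fin.not_lt_zero p.i (p.lt 0 ?_)
    rw [hI]
    exact Finset.mem_erase.2 ⟨Ne.symm hne, Finset.mem_univ _⟩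
  rw [hI, hi]

theorem val_entry (hp : p.r = l) (t : Fin p.r) : (p.entry t : ℕ) = t + 1 := by
  have h : (fun t : Fin p.r => (⟨t + 1, by omega⟩ : Fin (l + 1))) = p.I.orderEmbOfFin rfl := by
    refine Finset.orderEmbOfFin_unique rfl (fun t => ?_) fun s t h => Nat.succ_lt_succ h
    rw [Idx.I_eq_of_r_eq hp, Finset.mem_erase]
    exact ⟨Fin.ne_of_val_ne (by simp), Finset.mem_univ _⟩
  rw [Idx.entry, ← congrFun h t]

theorem entryPred_eq_cast (hp : p.r = l) (t : Fin p.r) : p.entryPred t = Fin.cast hp t := by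
  ext
  rw [Idx.entryPred, Fin.val_pred, val_entry hp, Nat.add_sub_cancel, Fin.val_cast]

theorem toFinset_phiWord_of_r_eq (hp : p.r = l) (u : Fin l) :
    (phiWord l p (u.cast hp.symm)).toFinset = Finset.Ioi u.castSucc := by
  have hletter {b : ℕ} (hb : b < p.r) :
      (letter p (u.cast hp.symm) b : ℕ) = max (u : ℕ) (p.r - (b + 1)) + 1 := by
    rw [letter_of_lt _ hb, val_entry hp, Fin.coe_max, Fin.val_rev, Fin.val_cast]
  ext j
  simp only [phiWord, List.mem_toFinset, List.mem_map, List.mem_range, Finset.mem_Ioi, Fin.lt_def,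
    Fin.val_castSucc]
  constructor
  · rintro ⟨b, hb, rfl⟩
    rw [hletter (hb.trans_eq hp.symm)]
    omega
  · intro hj
    refine ⟨l - j, by omega, Fin.ext ?_⟩
    rw [hletter (by omega)]
    omega

theorem phi_upKamekoIter_monomial_of_r_eq (hp : p.r = l) {b : Fin l →₀ ℕ} {u : Fin l}
    (hu : b u ≠ 0) (hmin : ∀ t < u, b t = 0) :
    phi p (upKamekoIter l l (monomial b 1)) =
      upKamekoWord (phiWord l p (u.cast hp.symm)) (f p.i (monomial b 1)) := by
  have hI : p.I ≠ ∅ := by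
    refine Finset.nonempty_iff_ne_empty.1 (Finset.card_pos.1 ?_)
    exact u.pos.trans_eq hp.symm
  refine phi_upKamekoIter_monomial hI hp.le (compatible_upKamekoExp hp.le (fun t ht => ?_) ?_)
  · exact ⟨hp, entryPred_eq_cast hp t ▸ hmin _ ht⟩
  · exact .inr (entryPred_eq_cast hp _ ▸ hu)

/-- The substitution which annihilates the variables before `x_u`. -/
noncomputable def killBefore (l u : ℕ) : P l →ₐ[ZMod 2] P l :=
  aeval fun j : Fin l => if u ≤ j then X j else 0

theorem isLinearSubst_killBefore (l u : ℕ) : IsLinearSubst (killBefore l u) := fun j => by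
  rw [killBefore, aeval_X]
  split_ifs
  · exact ⟨{j}, by simp⟩
  · exact ⟨∅, by simp⟩

theorem killBefore_monomial {b : Fin l →₀ ℕ} {u : Fin l} (hu : b u ≠ 0)
    (hmin : ∀ t < u, b t = 0) (v : ℕ) :
    killBefore l v (monomial b 1) = if v ≤ u then monomial b 1 else 0 := by
  rw [killBefore, aeval_monomial, map_one, one_mul]
  split_ifs with hv
  · rw [monomial_eq, C_1, one_mul]
    refine Finsupp.prod_congr fun j hj => ?_
    have huj : u ≤ j := by
      by_contra! hju
      exact Finsupp.mem_support_iff.1 hj (hmin j hju)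
    rw [if_pos (hv.trans huj)]
  · refine Finset.prod_eq_zero (Finsupp.mem_support_iff.2 hu) ?_
    simp only [if_neg hv, zero_pow hu]

/-- The part of a polynomial formed by the monomials in which `x_u` is the first variable that
occurs. -/
noncomputable def leadingPart (u : Fin l) : P l →ₗ[ZMod 2] P l :=
  (killBefore l u).toLinearMap - (killBefore l (u + 1)).toLinearMap

theorem leadingPart_monomial {b : Fin l →₀ ℕ} {u : Fin l} (hu : b u ≠ 0)
    (hmin : ∀ t < u, b t = 0) (v : Fin l) :
    leadingPart v (monomial b 1) = if v = u then monomial b 1 else 0 := by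
  rw [leadingPart, LinearMap.sub_apply, AlgHom.toLinearMap_apply, AlgHom.toLinearMap_apply,
    killBefore_monomial hu hmin, killBefore_monomial hu hmin]
  rcases lt_trichotomy v u with h | rfl | h
  · rw [if_pos (Fin.le_def.1 h.le), if_pos (Nat.succ_le_of_lt h), sub_self, if_neg h.ne]
  · rw [if_pos le_rfl, if_neg (Nat.not_succ_le_self _), sub_zero, if_pos rfl]
  · rw [if_neg (Nat.not_le.2 h), if_neg (by omega), sub_self, if_neg h.ne']

theorem leadingPart_isHomogeneous {m : ℕ} {y : P l} (hy : y.IsHomogeneous m) (u : Fin l) :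
    (leadingPart u y).IsHomogeneous m :=
  ((isLinearSubst_killBefore l u).isHomogeneous_map hy).sub
    ((isLinearSubst_killBefore l _).isHomogeneous_map hy)

theorem leadingPart_mem_hit {y : P l} (hy : y ∈ hit l) (u : Fin l) : leadingPart u y ∈ hit l :=
  sub_mem ((isLinearSubst_killBefore l u).map_mem_hit hy)
    ((isLinearSubst_killBefore l _).map_mem_hit hy)

theorem exists_leading_variable {b : Fin l →₀ ℕ} (hb : 0 < b.degree) :
    ∃ u, b u ≠ 0 ∧ ∀ t < u, b t = 0 := by
  have hsupport : b.support.Nonempty := by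
    rw [Finsupp.support_nonempty_iff]
    rintro rfl
    simp at hb
  refine ⟨b.support.min' hsupport, Finsupp.mem_support_iff.1 (Finset.min'_mem _ _),
    fun t ht => ?_⟩
  by_contra ht'
  exact ht.not_ge (Finset.min'_le _ _ (Finsupp.mem_support_iff.2 ht'))

theorem phi_upKamekoIter_of_r_eq (hp : p.r = l) {m : ℕ} (hm : 0 < m) {y : P l}
    (hy : y.IsHomogeneous m) :
    phi p (upKamekoIter l l y) = ∑ u : Fin l,
      upKamekoWord (phiWord l p (u.cast hp.symm)) (f p.i (leadingPart u y)) := by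
  have h : y ∈ LinearMap.eqLocus (phi p ∘ₗ upKamekoIter l l)
      (∑ u : Fin l, upKamekoWord (phiWord l p (u.cast hp.symm)) ∘ₗ
        (f p.i).toLinearMap ∘ₗ leadingPart u) := by
    refine mem_of_isHomogeneous (fun b hb => ?_) hy
    obtain ⟨u, hu, hmin⟩ := exists_leading_variable (hb ▸ hm)
    rw [LinearMap.mem_eqLocus, LinearMap.sum_apply, Finset.sum_eq_single u]
    · simpa [leadingPart_monomial hu hmin] using phi_upKamekoIter_monomial_of_r_eq hp hu hmin
    · intro v _ hv
      simp [leadingPart_monomial hu hmin, hv]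
    · simp
  simpa [LinearMap.mem_eqLocus] using h

end LongestIndex

section PhiOfHits

variable {l m d : ℕ}

theorem phi_upKamekoIter_mem_hit (hμ : l ≤ mu (2 * m + l)) (hm : 0 < m) (hd : l ≤ d)
    (p : Idx (l + 1)) {y : P l} (hy : y ∈ hit l) (hdeg : y.IsHomogeneous m) :
    phi p (upKamekoIter l d y) ∈ hit (l + 1) := by
  have hword (L : List (Fin (l + 1))) {w : P l} (hw : w ∈ hit l) (hwm : w.IsHomogeneous m) :
      upKamekoWord L (f p.i w) ∈ hit (l + 1) :=
    upKamekoWord_mem_hit (e := 0) hμ L ((isLinearSubst_f p.i).map_mem_hit hw)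
      ((isLinearSubst_f p.i).isHomogeneous_map hwm)
  rcases (p.r_le.trans hd).lt_or_eq with h | h
  · obtain ⟨L, -, -, hL⟩ := exists_word_of_r_lt h
    exact hL y ▸ hword L hy hdeg
  · obtain rfl : d = l := le_antisymm (h ▸ p.r_le) hd
    rw [phi_upKamekoIter_of_r_eq h hm hdeg]
    exact Submodule.sum_mem _ fun u _ =>
      hword _ (leadingPart_mem_hit hy u) (leadingPart_isHomogeneous hdeg u)

theorem phi_mem_hit (hμ : l ≤ mu (2 * m + l)) (hm : 0 < m) (hd : l ≤ d) (p : Idx (l + 1))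
    {w : P l} (hw : w ∈ hit l) (hdeg : w.IsHomogeneous (kamekoDegree l m d)) :
    phi p w ∈ hit (l + 1) := by
  obtain ⟨y, hy, hwy⟩ := exists_upKamekoIter_sub_mem_irregular hdeg
  have hiter : upKamekoIter l d y ∈ hit l := by
    simpa using sub_mem hw (irregular_le_hit hμ d hwy)
  have hphi := phi_upKamekoIter_mem_hit hμ hm hd p (mem_hit_of_upKamekoIter_mem_hit hiter) hy
  simpa using add_mem (phi_mem_hit_of_mem_irregular hμ p hwy) hphi

end PhiOfHits

section Restriction

variable {l : ℕ} {p : Idx (l + 1)}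

theorem Idx.i_le_of_mem_supp {j : Fin (l + 1)} (hj : j ∈ p.supp) : p.i ≤ j := by
  rcases Finset.mem_insert.1 hj with rfl | hj
  · exact le_rfl
  · exact (p.lt j hj).le

theorem Idx.i_notMem_I (p : Idx (l + 1)) : p.i ∉ p.I := fun h => lt_irrefl _ (p.lt _ h)

theorem exists_supp_eq {T : Finset (Fin (l + 1))} (hT : T.Nonempty) :
    ∃ p : Idx (l + 1), p.supp = T := by
  refine ⟨⟨T.min' hT, T.erase (T.min' hT), fun j hj => ?_⟩,
    Finset.insert_erase (Finset.min'_mem T hT)⟩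
  exact lt_of_le_of_ne (Finset.min'_le _ _ (Finset.mem_of_mem_erase hj))
    (Finset.ne_of_mem_erase hj).symm

theorem exists_f_eq {i : Fin (l + 1)} {y : P (l + 1)} (hy : y ∈ supported (ZMod 2) {i}ᶜ) :
    ∃ z, f i z = y :=
  exists_rename_eq_of_vars_subset_range y i.succAbove Fin.succAbove_right_injective
    (by rwa [Fin.range_succAbove, ← mem_supported])

theorem f_mem_supported (i : Fin (l + 1)) (y : P l) : f i y ∈ supported (ZMod 2) {i}ᶜ := by
  rw [mem_supported]
  intro j hj
  obtain ⟨s, -, rfl⟩ := Finset.mem_image.1 (vars_rename _ _ hj)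
  exact Fin.succAbove_ne i s

theorem f_proj_X_self (p : Idx (l + 1)) : f p.i (proj p (X p.i)) = ∑ j ∈ p.I, X j := by
  calc _ = ∑ s, if p.i.succAbove s ∈ p.I then X (p.i.succAbove s) else 0 := by
        rw [proj_X_self, map_sum, Finset.sum_filter]
        simp only [f_X]
    _ = ∑ j, if j ∈ p.I then X j else 0 := by
        rw [Fin.sum_univ_succAbove _ p.i, if_neg p.i_notMem_I, zero_add]
    _ = ∑ j ∈ p.I, X j := by rw [Finset.sum_ite_mem, Finset.univ_inter]

theorem f_proj_X_succAbove (p : Idx (l + 1)) (s : Fin l) :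
    f p.i (proj p (X (p.i.succAbove s))) = X (p.i.succAbove s) := by
  rw [proj_X_succAbove, f_X]

theorem exists_eq_f_proj_add (p : Idx (l + 1)) (y : P (l + 1)) :
    ∃ w, y = f p.i (proj p y) + (∑ j ∈ p.supp, X j) * w := by
  set J : Ideal (P (l + 1)) := Ideal.span {∑ j ∈ p.supp, X j}
  have hquotient : Ideal.Quotient.mkₐ (ZMod 2) J =
      (Ideal.Quotient.mkₐ (ZMod 2) J).comp ((f p.i).comp (proj p)) := by
    ext1 j
    rw [AlgHom.comp_apply, AlgHom.comp_apply]
    rcases Fin.eq_self_or_eq_succAbove p.i j with rfl | ⟨s, rfl⟩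
    · rw [f_proj_X_self]
      refine Ideal.Quotient.eq.2 (Ideal.mem_span_singleton.2 ?_)
      rw [Idx.supp, Finset.sum_insert p.i_notMem_I, CharTwo.sub_eq_add]
    · rw [f_proj_X_succAbove]
  obtain ⟨w, hw⟩ :=
    Ideal.mem_span_singleton.1 (Ideal.Quotient.eq.1 (DFunLike.congr_fun hquotient y))
  exact ⟨w, eq_add_of_sub_eq' hw⟩

theorem f_proj_mem_supported {s : Set (Fin (l + 1))} (hs : (p.supp : Set (Fin (l + 1))) ⊆ s)
    {y : P (l + 1)} (hy : y ∈ supported (ZMod 2) s) :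
    f p.i (proj p y) ∈ supported (ZMod 2) (s \ {p.i}) := by
  have hle : supported (ZMod 2) s ≤
      (supported (ZMod 2) (s \ {p.i})).comap ((f p.i).comp (proj p)) := by
    refine Algebra.adjoin_le ?_
    rintro _ ⟨j, hj, rfl⟩
    change f p.i (proj p (X j)) ∈ supported (ZMod 2) (s \ {p.i})
    rcases Fin.eq_self_or_eq_succAbove p.i j with rfl | ⟨t, rfl⟩
    · rw [f_proj_X_self]
      exact sum_mem fun t ht =>
        X_mem_supported.2 ⟨hs (Finset.mem_insert_of_mem ht), (p.lt t ht).ne'⟩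
    · rw [f_proj_X_succAbove]
      exact X_mem_supported.2 ⟨hj, Fin.succAbove_ne _ _⟩
  exact hle hy

end Restriction

section ZeroSumFamilies

variable {l : ℕ} {M : Type*} [AddCommGroup M] [Module (ZMod 2) M]

/-- A family of linear maps on `P_k`, indexed by sets of variables, which satisfies the relations
`∑_j D_{S ∪ {j}}(x_j w) = 0`. -/
def IsZeroSumFamily (D : Finset (Fin (l + 1)) → P (l + 1) →ₗ[ZMod 2] M) : Prop :=
  ∀ S w, ∑ j, D (insert j S) (X j * w) = 0

/-- The sets which contain `j` and those which do not are matched by insertion of `j`. -/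
theorem sum_insert_eq_zero {ι : Type*} [Fintype ι] [DecidableEq ι] {T : Finset ι} {j : ι}
    (hj : j ∉ T) (F : Finset ι → M) : ∑ S with T ⊆ S, F (insert j S) = 0 := by
  rw [← Finset.sum_filter_add_sum_filter_not _ (j ∈ ·)]
  have h : ∑ S ∈ {S | T ⊆ S} with j ∈ S, F (insert j S) =
      ∑ S ∈ {S | T ⊆ S} with j ∉ S, F (insert j S) := by
    refine Finset.sum_bij' (fun S _ => S.erase j) (fun S _ => insert j S) ?_ ?_ ?_ ?_ ?_
    all_goals simp +contextual [Finset.subset_erase, hj, Finset.subset_insert_iff_of_notMem]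
  rw [h, ZModModule.add_self]

variable {D : Finset (Fin (l + 1)) → P (l + 1) →ₗ[ZMod 2] M}

/-- The sum of all the relations vanishes identically. -/
theorem isZeroSumFamily_of_ne_univ
    (hD : ∀ S, S ≠ Finset.univ → ∀ w, ∑ j, D (insert j S) (X j * w) = 0) : IsZeroSumFamily D := by
  intro S w
  rcases ne_or_eq S Finset.univ with h | rfl
  · exact hD S h w
  have hall : ∑ S with ∅ ⊆ S, ∑ j, D (insert j S) (X j * w) = 0 := by
    rw [Finset.sum_comm]
    exact Finset.sum_eq_zero fun j _ =>
      sum_insert_eq_zero (Finset.notMem_empty j) fun S => D S (X j * w)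
  rwa [Finset.sum_eq_single_of_mem Finset.univ (by simp) fun S _ hS => hD S hS w] at hall

namespace IsZeroSumFamily

theorem sum_superset_eq_zero (hD : IsZeroSumFamily D) (T : Finset (Fin (l + 1))) (w : P (l + 1)) :
    ∑ S with T ⊆ S, D S ((∑ j ∈ T, X j) * w) = 0 := by
  have h : ∑ j, ∑ S with T ⊆ S, D (insert j S) (X j * w) = 0 := by
    rw [Finset.sum_comm]
    exact Finset.sum_eq_zero fun S _ => hD S w
  rw [← Finset.sum_subset (Finset.subset_univ T) fun j _ hj =>
    sum_insert_eq_zero hj fun S => D S (X j * w), Finset.sum_comm] at h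
  rw [← h]
  refine Finset.sum_congr rfl fun S hS => ?_
  rw [Finset.sum_mul, map_sum]
  refine Finset.sum_congr rfl fun j hj => ?_
  rw [Finset.insert_eq_of_mem ((Finset.mem_filter.1 hS).2 hj)]

theorem sum_superset_eq (hD : IsZeroSumFamily D) (p : Idx (l + 1)) (y : P (l + 1)) :
    ∑ S with p.supp ⊆ S, D S y = ∑ S with p.supp ⊆ S, D S (f p.i (proj p y)) := by
  obtain ⟨w, hw⟩ := exists_eq_f_proj_add p y
  conv_lhs => rw [hw]
  simp only [map_add, Finset.sum_add_distrib, hD.sum_superset_eq_zero, add_zero]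

theorem mem_of_sum_mem (hD : IsZeroSumFamily D) {V : Submodule (ZMod 2) M} {p : Idx (l + 1)}
    {T : Finset (Fin (l + 1))} (hT : p.supp ⊆ T) {y : P (l + 1)}
    (hself : D T (f p.i (proj p y)) ∈ V)
    (hrest : ∀ S, p.supp ⊆ S → S ≠ T → D S y ∈ V ∧ D S (f p.i (proj p y)) ∈ V) : D T y ∈ V := by
  have hTmem : T ∈ ({S | p.supp ⊆ S} : Finset (Finset (Fin (l + 1)))) := by simpa using hT
  have hrest' : ∀ S ∈ ({S | p.supp ⊆ S} : Finset (Finset (Fin (l + 1)))).erase T,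
      D S y ∈ V ∧ D S (f p.i (proj p y)) ∈ V := fun S hS =>
    hrest S (Finset.mem_filter.1 (Finset.mem_of_mem_erase hS)).2 (Finset.ne_of_mem_erase hS)
  have h := hD.sum_superset_eq p y
  rw [← Finset.add_sum_erase _ _ hTmem, ← Finset.add_sum_erase _ _ hTmem,
    ← eq_sub_iff_add_eq] at h
  rw [h]
  exact sub_mem (add_mem hself (sum_mem fun S hS => (hrest' S hS).2))
    (sum_mem fun S hS => (hrest' S hS).1)

theorem mem (hD : IsZeroSumFamily D) {V : Submodule (ZMod 2) M}
    (hV : ∀ (p : Idx (l + 1)) (y : P l), D p.supp (f p.i y) ∈ V) {T : Finset (Fin (l + 1))}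
    (hT : T.Nonempty) (y : P (l + 1)) : D T y ∈ V := by
  induction T using WellFoundedGT.induction generalizing y with
  | _ T ih =>
    obtain ⟨p, rfl⟩ := exists_supp_eq hT
    refine hD.mem_of_sum_mem subset_rfl (hV p _) fun S hS hne => ?_
    have ih := ih S (hS.ssubset_of_ne hne.symm) (hT.mono hS)
    exact ⟨ih _, ih _⟩

end IsZeroSumFamily

/-- The element of `𝒩_k` formed by all the indices after `u`. -/
def tailIdx (u : Fin l) : Idx (l + 1) := ⟨u.succ, Finset.Ioi u.succ, fun _ => Finset.mem_Ioi.1⟩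

theorem supp_tailIdx (u : Fin l) : (tailIdx u).supp = Finset.Ioi u.castSucc := by
  ext j
  rw [Idx.supp, tailIdx, Finset.Ioi_insert, Finset.mem_Ici, Finset.mem_Ioi,
    Fin.castSucc_lt_iff_succ_le]

theorem supp_tailIdx_ne_univ (u : Fin l) : (tailIdx u).supp ≠ Finset.univ := by
  rw [supp_tailIdx]
  exact fun h => lt_irrefl _ (Finset.mem_Ioi.1 (h.ge (Finset.mem_univ u.castSucc)))

theorem coe_Ioi_castSucc_sdiff (u : Fin l) :
    (Finset.Ioi u.castSucc : Set (Fin (l + 1))) \ {u.succ} = Finset.Ioi u.succ := by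
  ext j
  simp [Fin.ext_iff, Fin.lt_def]
  omega

variable {V : Submodule (ZMod 2) M}

theorem mem_of_mem_supported
    (hV : ∀ (p : Idx (l + 1)) (y : P l), p.supp ≠ Finset.univ → D p.supp (f p.i y) ∈ V)
    {p : Idx (l + 1)} (hp : p.supp ≠ Finset.univ) {s : Set (Fin (l + 1))} (hi : p.i ∉ s)
    {y : P (l + 1)} (hy : y ∈ supported (ZMod 2) s) : D p.supp y ∈ V := by
  obtain ⟨z, rfl⟩ := exists_f_eq (supported_mono (Set.subset_compl_singleton_iff.2 hi) hy)
  exact hV p z hp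

theorem mem_of_Ioi_ssubset
    (hV : ∀ (p : Idx (l + 1)) (y : P l), p.supp ≠ Finset.univ → D p.supp (f p.i y) ∈ V)
    {u : Fin (l + 1)} {S : Finset (Fin (l + 1))} (hS : Finset.Ioi u ⊂ S) (hne : S ≠ Finset.univ)
    {y : P (l + 1)} (hy : y ∈ supported (ZMod 2) (Finset.Ioi u : Set (Fin (l + 1)))) :
    D S y ∈ V := by
  obtain ⟨j, hj, hju⟩ := Finset.exists_of_ssubset hS
  obtain ⟨p, rfl⟩ := exists_supp_eq ⟨j, hj⟩
  refine mem_of_mem_supported hV hne (fun hi => hju ?_) hy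
  exact Finset.mem_Ioi.2 ((Finset.mem_Ioi.1 (Finset.mem_coe.1 hi)).trans_le
    (Idx.i_le_of_mem_supp hj))

theorem mem_of_forall_monomial_mem_of_supported {s : Set (Fin (l + 1))}
    {W : Submodule (ZMod 2) (P (l + 1))}
    (h : ∀ c : Fin (l + 1) →₀ ℕ, (c.support : Set (Fin (l + 1))) ⊆ s → monomial c 1 ∈ W)
    {y : P (l + 1)} (hy : y ∈ supported (ZMod 2) s) : y ∈ W :=
  mem_of_forall_monomial_mem fun a ha => h a fun j hj =>
    mem_supported.1 hy ((mem_vars_iff_mem_support j).2 ⟨a, ha, hj⟩)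

/-- The relations for the sets which contain the last variables move the class of the full set to
those of the sets of last variables. -/
theorem IsZeroSumFamily.univ_mem_of_mem_supported_Ioi (hD : IsZeroSumFamily D)
    (hV : ∀ (p : Idx (l + 1)) (y : P l), p.supp ≠ Finset.univ → D p.supp (f p.i y) ∈ V)
    (hone : D Finset.univ 1 = 0)
    (htail : ∀ (u : Fin l) (c : Fin (l + 1) →₀ ℕ), (∀ j ≤ u.castSucc, c j = 0) →
      c u.succ ≠ 0 → D (Finset.Ioi u.castSucc) (monomial c 1) ∈ V)
    (u : Fin (l + 1)) {y : P (l + 1)}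
    (hy : y ∈ supported (ZMod 2) (Finset.Ioi u : Set (Fin (l + 1)))) : D Finset.univ y ∈ V := by
  induction u using Fin.reverseInduction generalizing y with
  | last =>
    refine mem_of_forall_monomial_mem_of_supported (W := V.comap (D Finset.univ))
      (fun c hc => ?_) hy
    have hc : c = 0 := by simpa [← Fin.top_eq_last] using hc
    rw [Submodule.mem_comap, hc, ← C_apply, C_1, hone]
    exact zero_mem V
  | cast u ih =>
    refine mem_of_forall_monomial_mem_of_supported (W := V.comap (D Finset.univ))
      (fun c hc => ?_) hy
    have hy : (monomial c 1 : P (l + 1)) ∈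
        supported (ZMod 2) (Finset.Ioi u.castSucc : Set (Fin (l + 1))) := by
      rwa [mem_supported, vars_monomial one_ne_zero]
    have hsupported := f_proj_mem_supported (p := tailIdx u) (supp_tailIdx u ▸ subset_rfl) hy
    have hne := supp_tailIdx_ne_univ u
    refine hD.mem_of_sum_mem (p := tailIdx u) (Finset.subset_univ _)
      (ih (coe_Ioi_castSucc_sdiff u ▸ hsupported)) fun S hS hSne => ?_
    rcases hS.eq_or_ssubset with rfl | hS
    · refine ⟨?_, hV _ _ hne⟩
      by_cases hu : c u.succ = 0
      · refine mem_of_mem_supported hV hne (s := {u.succ}ᶜ) (by simp [tailIdx]) ?_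
        simpa [mem_supported, vars_monomial one_ne_zero] using hu
      · rw [supp_tailIdx]
        refine htail u c (fun j hj => ?_) hu
        by_contra hj'
        simpa using hj.trans_lt (Finset.mem_Ioi.1 (hc (Finsupp.mem_support_iff.2 hj')))
    · rw [supp_tailIdx] at hS
      exact ⟨mem_of_Ioi_ssubset hV hS hSne hy,
        mem_of_Ioi_ssubset hV hS hSne (supported_mono Set.sdiff_subset hsupported)⟩

theorem IsZeroSumFamily.mem_of_tails (hD : IsZeroSumFamily D)
    (hV : ∀ (p : Idx (l + 1)) (y : P l), p.supp ≠ Finset.univ → D p.supp (f p.i y) ∈ V)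
    (hone : D Finset.univ 1 = 0)
    (htail : ∀ (u : Fin l) (c : Fin (l + 1) →₀ ℕ), (∀ j ≤ u.castSucc, c j = 0) →
      c u.succ ≠ 0 → D (Finset.Ioi u.castSucc) (monomial c 1) ∈ V)
    {T : Finset (Fin (l + 1))} (hT : T.Nonempty) (y : P (l + 1)) : D T y ∈ V := by
  refine hD.mem (fun p y => ?_) hT y
  by_cases hp : p.supp = Finset.univ
  · have hi : p.i = 0 := Fin.le_zero_iff.1 (Idx.i_le_of_mem_supp (hp ▸ Finset.mem_univ 0))
    rw [hp, hi]
    refine hD.univ_mem_of_mem_supported_Ioi hV hone htail 0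
      (supported_mono ?_ (f_mem_supported 0 y))
    intro j hj
    simpa [Fin.pos_iff_ne_zero] using hj
  · exact hV p y hp

end ZeroSumFamilies

section ExtensionAlongVariables

variable {σ R M : Type*} [CommSemiring R] [AddCommMonoid M] [Module R M]

theorem exists_linearMap_X_mul (φ : σ → MvPolynomial σ R →ₗ[R] M)
    (hφ : ∀ p q w, φ q (X p * w) = φ p (X q * w)) :
    ∃ Φ : MvPolynomial σ R →ₗ[R] M, Φ 1 = 0 ∧ ∀ q w, Φ (X q * w) = φ q w := by
  classical
  let Φ : MvPolynomial σ R →ₗ[R] M := (basisMonomials σ R).constr R fun c =>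
    if h : c.support.Nonempty then φ h.choose (monomial (c - Finsupp.single h.choose 1) 1) else 0
  have hΦ (c : σ →₀ ℕ) : Φ (monomial c 1) =
      if h : c.support.Nonempty then φ h.choose (monomial (c - Finsupp.single h.choose 1) 1)
      else 0 := by
    simpa [Φ] using (basisMonomials σ R).constr_basis R _ c
  refine ⟨Φ, ?_, fun q w => ?_⟩
  · rw [← C_1, C_apply, hΦ, dif_neg (by simp)]
  have hw : w ∈ LinearMap.eqLocus (Φ ∘ₗ LinearMap.mulLeft R (X q)) (φ q) :=
    mem_of_forall_monomial_mem fun a _ => by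
      rw [LinearMap.mem_eqLocus, LinearMap.comp_apply, LinearMap.mulLeft_apply, ← pow_one (X q),
        ← monomial_single_add, hΦ]
      have hne : (Finsupp.single q 1 + a : σ →₀ ℕ).support.Nonempty := ⟨q, by simp⟩
      rw [dif_pos hne]
      have hi : (Finsupp.single q 1 + a : σ →₀ ℕ) hne.choose ≠ 0 :=
        Finsupp.mem_support_iff.1 hne.choose_spec
      generalize hne.choose = i at hi ⊢
      rcases eq_or_ne i q with rfl | hiq
      · rw [add_tsub_cancel_left]
      · rw [Finsupp.add_apply, Finsupp.single_eq_of_ne hiq, zero_add] at hi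
        obtain ⟨b, rfl⟩ := exists_add_of_le
          (Finsupp.single_le_iff.2 (Nat.one_le_iff_ne_zero.2 hi))
        rw [add_left_comm, add_tsub_cancel_left, monomial_single_add, monomial_single_add,
          pow_one, pow_one, hφ]
  exact hw

end ExtensionAlongVariables

section WordClasses

variable {l m d : ℕ}

theorem exists_toFinset_eq {α : Type*} [DecidableEq α] {S : Finset α} (hS : S.Nonempty)
    (hd : S.card ≤ d) : ∃ L : List α, L.length = d ∧ L.toFinset = S := by
  obtain ⟨i, hi⟩ := hS
  refine ⟨List.replicate (d - S.card) i ++ S.toList, by simp; omega, ?_⟩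
  ext j
  simp only [List.mem_toFinset, List.mem_append, List.mem_replicate, Finset.mem_toList]
  exact ⟨by rintro (⟨-, rfl⟩ | h) <;> assumption, .inr⟩

open Classical in
/-- The class of the image of the degree-`m` part of a polynomial under a word of length `d` whose
set of letters is `S`; it is `0` if there is no such word. -/
noncomputable def wordClass (d m : ℕ) (S : Finset (Fin (l + 1))) :
    P (l + 1) →ₗ[ZMod 2] P (l + 1) ⧸ hit (l + 1) :=
  if h : ∃ L : List (Fin (l + 1)), L.length = d ∧ L.toFinset = S then
    hitClass ∘ₗ upKamekoWord h.choose ∘ₗ homogeneousComponent m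
  else 0

/-- The family is given on the sets of letters of the words of length `d` by those words. -/
def IsWordFamily (d m : ℕ)
    (D : Finset (Fin (l + 1)) → P (l + 1) →ₗ[ZMod 2] P (l + 1) ⧸ hit (l + 1)) : Prop :=
  ∀ (L : List (Fin (l + 1))) (y : P (l + 1)), L.length = d →
    D L.toFinset y = hitClass (upKamekoWord L (homogeneousComponent m y))

theorem isWordFamily_wordClass (hμ : l ≤ mu (2 * m + l)) :
    IsWordFamily d m (wordClass (l := l) d m) := by
  rintro L y rfl
  have h : ∃ L' : List (Fin (l + 1)), L'.length = L.length ∧ L'.toFinset = L.toFinset :=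
    ⟨L, rfl, rfl⟩
  rw [wordClass, dif_pos h]
  exact hitClass_upKamekoWord_congr (e := 0) hμ h.choose_spec.1 h.choose_spec.2
    (homogeneousComponent_isHomogeneous _ _)

theorem wordClass_one (hm : 0 < m) (S : Finset (Fin (l + 1))) : wordClass d m S 1 = 0 := by
  have h : homogeneousComponent m (1 : P (l + 1)) = 0 := by
    rw [← C_1, C_apply, homogeneousComponent_monomial, if_neg (by simpa using hm.ne)]
  rw [wordClass]
  split_ifs
  · rw [LinearMap.comp_apply, LinearMap.comp_apply, h, map_zero, map_zero]
  · rfl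

theorem wordClass_eq_zero_of_mem_hit (hμ : l ≤ mu (2 * m + l)) (S : Finset (Fin (l + 1)))
    {y : P (l + 1)} (hy : y ∈ hit (l + 1)) : wordClass d m S y = 0 := by
  rw [wordClass]
  split_ifs
  · rw [LinearMap.comp_apply, LinearMap.comp_apply, hitClass_eq_zero]
    exact upKamekoWord_mem_hit (e := 0) hμ _ (homogeneousComponent_mem_hit m hy)
      (homogeneousComponent_isHomogeneous _ _)
  · rfl

theorem sum_wordClass_insert_X_mul (hμ : l ≤ mu (2 * m + l)) (hm : 0 < m)
    {S : Finset (Fin (l + 1))} (hS : S.card < d) (w : P (l + 1)) :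
    ∑ j, wordClass d m (insert j S) (X j * w) = 0 := by
  obtain ⟨m, rfl⟩ := Nat.exists_eq_succ_of_ne_zero hm.ne'
  obtain ⟨d, rfl⟩ := Nat.exists_eq_succ_of_ne_zero (Nat.ne_zero_of_lt hS)
  set v := homogeneousComponent m w
  have hv (j : Fin (l + 1)) : (X j * v).IsHomogeneous (m + 1) :=
    add_comm 1 m ▸ (isHomogeneous_X (ZMod 2) j).mul (homogeneousComponent_isHomogeneous m w)
  rcases S.eq_empty_or_nonempty with rfl | hne
  · have hword (j : Fin (l + 1)) : wordClass (d + 1) (m + 1) (insert j ∅) (X j * w) =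
        hitClass (upKamekoWord (List.replicate (d + 1) j) (X j * v)) := by
      rw [← homogeneousComponent_X_mul,
        ← isWordFamily_wordClass hμ _ _ List.length_replicate,
        List.toFinset_replicate_of_ne_zero (Nat.succ_ne_zero d), insert_empty_eq]
    rw [Finset.sum_congr rfl fun j _ => hword j, ← map_sum, hitClass_eq_zero]
    exact sum_upKamekoWord_replicate_mem_hit d v
  · obtain ⟨L, hL, rfl⟩ := exists_toFinset_eq hne (Nat.lt_succ_iff.1 hS)
    have hword (j : Fin (l + 1)) : wordClass (d + 1) (m + 1) (insert j L.toFinset) (X j * w) =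
        hitClass (upKamekoWord L (upKamekoOmit j (X j * v))) := by
      have h := isWordFamily_wordClass (d := d + 1) hμ (L ++ [j]) (X j * w) (by simp [hL])
      rw [List.toFinset_append, Finset.union_comm, homogeneousComponent_X_mul, upKamekoWord_append,
        upKamekoWord_cons, upKamekoWord_nil] at h
      exact h
    rw [Finset.sum_congr rfl fun j _ => hword j, ← map_sum, ← map_sum, hitClass_eq_zero]
    exact upKamekoWord_mem_hit (e := 1) hμ L (sum_upKamekoOmit_X_mul_mem_hit v)
      (IsHomogeneous.sum _ _ _ fun j _ =>
        upKameko_isHomogeneous_succ (e := 0) (card_univ_erase j) (hv j))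

theorem Sq_one_sum_X {k : ℕ} (A : Finset (Fin k)) :
    Sq k 1 (∑ j ∈ A, X j) = (∑ j ∈ A, X j) ^ 2 :=
  Sq_eq_sq (IsHomogeneous.sum A _ 1 fun j _ => isHomogeneous_X (ZMod 2) j)

/-- For `d = l` no word contains all the variables; this is the value which the relation for
`S = {x_j | j ≠ q}` forces on `x_q w` for the full set of variables. -/
noncomputable def forcedClass (m : ℕ) (q : Fin (l + 1)) :
    P (l + 1) →ₗ[ZMod 2] P (l + 1) ⧸ hit (l + 1) :=
  wordClass l m (Finset.univ.erase q) ∘ₗ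
    LinearMap.mulLeft (ZMod 2) (∑ j ∈ Finset.univ.erase q, X j)

theorem forcedClass_apply (q : Fin (l + 1)) (w : P (l + 1)) :
    forcedClass m q w =
      wordClass l m (Finset.univ.erase q) ((∑ j ∈ Finset.univ.erase q, X j) * w) := rfl

/-- With `σ = ∑_{j ≠ q} x_j`, the class of `x_p ((σ - x_p) w + Sq¹ w)` differs from that of
`σ x_p w` by `Sq¹(x_p w)`. -/
theorem forcedClass_X_mul (hμ : l ≤ mu (2 * m + l)) {p q : Fin (l + 1)} (hpq : p ≠ q)
    (w : P (l + 1)) : forcedClass m q (X p * w) = wordClass l m (Finset.univ.erase q)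
      (X p * ((∑ j ∈ (Finset.univ.erase q).erase p, X j) * w + Sq (l + 1) 1 w)) := by
  have hp : p ∈ Finset.univ.erase q := by simpa using hpq
  have hSq : Sq (l + 1) 1 (X p * w) = X p * Sq (l + 1) 1 w + X p ^ 2 * w := by
    rw [Sq_one_mul, Sq_eq_sq (isHomogeneous_X _ _)]
  have hsum : (∑ j ∈ Finset.univ.erase q, X j) * (X p * w) =
      X p * ((∑ j ∈ (Finset.univ.erase q).erase p, X j) * w + Sq (l + 1) 1 w) +
        Sq (l + 1) 1 (X p * w) := by
    rw [hSq, ← Finset.add_sum_erase _ _ hp]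
    linear_combination (-X p * Sq (l + 1) 1 w) * (CharTwo.two_eq_zero : (2 : P (l + 1)) = 0)
  rw [forcedClass_apply, hsum, map_add,
    wordClass_eq_zero_of_mem_hit hμ _ (Sq_mem_hit one_pos _), add_zero]

theorem forcedClass_X_mul_comm (hμ : l ≤ mu (2 * m + l)) (hm : 0 < m) (p q : Fin (l + 1))
    (w : P (l + 1)) : forcedClass m q (X p * w) = forcedClass m p (X q * w) := by
  rcases eq_or_ne p q with rfl | hpq
  · rfl
  have hp : p ∈ Finset.univ.erase q := by simpa using hpq
  have hq : q ∈ Finset.univ.erase p := by simpa using hpq.symm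
  set T : Finset (Fin (l + 1)) := (Finset.univ.erase q).erase p with hT
  have hT' : T = (Finset.univ.erase p).erase q := Finset.erase_right_comm
  have hcard : T.card < l := (Finset.card_erase_lt_of_mem hp).trans_eq (card_univ_erase q)
  set v : P (l + 1) := (∑ j ∈ T, X j) * w + Sq (l + 1) 1 w
  have hSq : (∑ j ∈ T, X j) * v = Sq (l + 1) 1 ((∑ j ∈ T, X j) * w) := by
    rw [Sq_one_mul, Sq_one_sum_X]
    ring
  have hsumT : ∑ j ∈ T, wordClass l m (insert j T) (X j * v) = 0 := by
    rw [Finset.sum_congr rfl fun j hj => by rw [Finset.insert_eq_of_mem hj], ← map_sum,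
      ← Finset.sum_mul, hSq]
    exact wordClass_eq_zero_of_mem_hit hμ T (Sq_mem_hit one_pos _)
  have hrel := sum_wordClass_insert_X_mul hμ hm hcard v
  rw [← Finset.sum_erase_add _ _ (Finset.mem_univ q), ← Finset.sum_erase_add _ _ hp, ← hT, hsumT,
    zero_add, add_eq_zero_iff_eq_neg, ZModModule.neg_eq_self] at hrel
  rw [forcedClass_X_mul hμ hpq, forcedClass_X_mul hμ hpq.symm, ← hT, ← hT']
  rwa [hT, Finset.insert_erase hp, ← hT, hT', Finset.insert_erase hq] at hrel

theorem card_le_of_ne_univ {S : Finset (Fin (l + 1))} (hS : S ≠ Finset.univ) : S.card ≤ l := by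
  simpa [Nat.lt_succ_iff] using Finset.card_lt_card (Finset.ssubset_univ_iff.2 hS)

theorem exists_isZeroSumFamily_of_eq (hμ : l ≤ mu (2 * m + l)) (hm : 0 < m) :
    ∃ D : Finset (Fin (l + 1)) → P (l + 1) →ₗ[ZMod 2] P (l + 1) ⧸ hit (l + 1),
      IsZeroSumFamily D ∧ D Finset.univ 1 = 0 ∧ IsWordFamily l m D := by
  obtain ⟨Φ, hΦ, hΦX⟩ := exists_linearMap_X_mul (forcedClass m) (forcedClass_X_mul_comm hμ hm)
  have hne {S : Finset (Fin (l + 1))} (hS : S.card ≤ l) :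
      Function.update (wordClass l m) Finset.univ Φ S = wordClass l m S := by
    refine Function.update_of_ne (fun h => ?_) _ _
    simp [h] at hS
  refine ⟨Function.update (wordClass l m) Finset.univ Φ,
    isZeroSumFamily_of_ne_univ fun S hS w => ?_, by rw [Function.update_self, hΦ],
    fun L y hL => ?_⟩
  · rcases (card_le_of_ne_univ hS).lt_or_eq with h | h
    · rw [← sum_wordClass_insert_X_mul hμ hm h w]
      exact Finset.sum_congr rfl fun j _ => by rw [hne ((Finset.card_insert_le j S).trans h)]
    · obtain ⟨q, hq⟩ := Finset.card_eq_one.1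
        (show Sᶜ.card = 1 by rw [Finset.card_compl, Fintype.card_fin, h]; omega)
      obtain rfl : S = Finset.univ.erase q := by rw [← compl_compl S, hq, Finset.compl_singleton]
      rw [← Finset.sum_erase_add _ _ (Finset.mem_univ q), Finset.insert_erase (Finset.mem_univ q),
        Function.update_self, hΦX, forcedClass_apply, Finset.sum_mul, map_sum,
        Finset.sum_congr rfl fun j hj => by rw [Finset.insert_eq_of_mem hj, hne h.le],
        ZModModule.add_self]
  · rw [hne (L.toFinset_card_le.trans_eq hL), isWordFamily_wordClass hμ L y hL]

theorem exists_isZeroSumFamily (hμ : l ≤ mu (2 * m + l)) (hm : 0 < m) (hd : l ≤ d) :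
    ∃ D : Finset (Fin (l + 1)) → P (l + 1) →ₗ[ZMod 2] P (l + 1) ⧸ hit (l + 1),
      IsZeroSumFamily D ∧ D Finset.univ 1 = 0 ∧ IsWordFamily d m D := by
  rcases hd.lt_or_eq with hd | rfl
  · refine ⟨wordClass d m, isZeroSumFamily_of_ne_univ fun S hS w => ?_, wordClass_one hm _,
      isWordFamily_wordClass hμ⟩
    exact sum_wordClass_insert_X_mul hμ hm ((card_le_of_ne_univ hS).trans_lt hd) w
  · exact exists_isZeroSumFamily_of_eq hμ hm

end WordClasses

section Spanning

variable {l m d : ℕ}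

theorem exists_f_eq_monomial {i : Fin (l + 1)} {c : Fin (l + 1) →₀ ℕ} (hc : c i = 0) :
    ∃ b : Fin l →₀ ℕ, f i (monomial b 1) = monomial c 1 ∧ b.degree = c.degree ∧
      ∀ s, b s = c (i.succAbove s) := by
  have hinj := (Fin.succAbove_right_injective (p := i)).injOn (s := i.succAbove ⁻¹' c.support)
  have hmap : (c.comapDomain i.succAbove hinj).mapDomain i.succAbove = c := by
    refine Finsupp.mapDomain_comapDomain _ Fin.succAbove_right_injective _ fun j hj => ?_
    rw [Fin.range_succAbove]
    rintro rfl
    exact Finsupp.mem_support_iff.1 hj hc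
  refine ⟨c.comapDomain i.succAbove hinj, ?_, ?_, fun s => rfl⟩
  · rw [f, rename_monomial, hmap]
  · rw [← Finsupp.degree_mapDomain i.succAbove, hmap]

variable {D : Finset (Fin (l + 1)) → P (l + 1) →ₗ[ZMod 2] P (l + 1) ⧸ hit (l + 1)}
  {V : Submodule (ZMod 2) (P (l + 1) ⧸ hit (l + 1))}

theorem IsWordFamily.supp_mem (hD : IsWordFamily d m D)
    (hV : ∀ (p : Idx (l + 1)) (y : P l), y.IsHomogeneous m →
      hitClass (phi p (upKamekoIter l d y)) ∈ V) {p : Idx (l + 1)} (hp : p.r < d) (y : P l) :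
    D p.supp (f p.i y) ∈ V := by
  obtain ⟨L, hL, hLp, hphi⟩ := exists_word_of_r_lt hp
  rw [← hLp, hD L _ hL, f, ← rename_homogeneousComponent, ← f, ← hphi]
  exact hV p _ (homogeneousComponent_isHomogeneous _ _)

theorem IsWordFamily.Ioi_mem (hD : IsWordFamily l m D)
    (hV : ∀ (p : Idx (l + 1)) (y : P l), y.IsHomogeneous m →
      hitClass (phi p (upKamekoIter l l y)) ∈ V) {u : Fin l} {c : Fin (l + 1) →₀ ℕ}
    (hc : ∀ j ≤ u.castSucc, c j = 0) (hu : c u.succ ≠ 0) :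
    D (Finset.Ioi u.castSucc) (monomial c 1) ∈ V := by
  let p : Idx (l + 1) := ⟨0, Finset.univ.erase 0, fun j hj =>
    Fin.pos_of_ne_zero (Finset.ne_of_mem_erase hj)⟩
  have hp : p.r = l := card_univ_erase 0
  obtain ⟨b, hb, hdeg, hbc⟩ := exists_f_eq_monomial (hc 0 (Fin.zero_le _))
  simp only [Fin.zero_succAbove] at hbc
  rw [← toFinset_phiWord_of_r_eq hp u, hD _ _ (length_phiWord _ _ _),
    homogeneousComponent_monomial]
  split_ifs with hcm
  · have hphi := phi_upKamekoIter_monomial_of_r_eq hp (b := b) (u := u) (by rwa [hbc])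
      fun t ht => by rw [hbc, hc _ (Fin.succ_le_castSucc_iff.2 ht)]
    rw [← hb, ← hphi]
    exact hV p _ (isHomogeneous_monomial _ (hdeg.trans hcm))
  · simp only [map_zero, zero_mem]

theorem Idx.supp_eq_univ {p : Idx (l + 1)} (hp : p.r = l) : p.supp = Finset.univ := by
  refine Finset.eq_univ_of_card _ ?_
  rw [Idx.supp, Finset.card_insert_of_notMem p.i_notMem_I, Fintype.card_fin]
  exact congrArg (· + 1) hp

theorem IsWordFamily.mem (hword : IsWordFamily d m D) (hzero : IsZeroSumFamily D)
    (hone : D Finset.univ 1 = 0) (hd : l ≤ d)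
    (hV : ∀ (p : Idx (l + 1)) (y : P l), y.IsHomogeneous m →
      hitClass (phi p (upKamekoIter l d y)) ∈ V) {T : Finset (Fin (l + 1))} (hT : T.Nonempty)
    (y : P (l + 1)) : D T y ∈ V := by
  rcases hd.lt_or_eq with hd | rfl
  · exact hzero.mem (fun p y => hword.supp_mem hV (p.r_le.trans_lt hd) y) hT y
  · refine hzero.mem_of_tails (fun p y hp => ?_) hone (fun u c hc hu => hword.Ioi_mem hV hc hu) hT y
    exact hword.supp_mem hV (p.r_le.lt_of_ne fun h => hp (Idx.supp_eq_univ h)) y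

theorem hitClass_mem_of_forall_phi_mem (hl : 0 < l) (hμ : l ≤ mu (2 * m + l)) (hm : 0 < m)
    (hd : l ≤ d)
    (hV : ∀ (p : Idx (l + 1)) (y : P l), y.IsHomogeneous m →
      hitClass (phi p (upKamekoIter l d y)) ∈ V)
    {w : P (l + 1)} (hw : w.IsHomogeneous (kamekoDegree l m d)) : hitClass w ∈ V := by
  obtain ⟨D, hzero, hone, hword⟩ := exists_isZeroSumFamily hμ hm hd
  refine mem_of_isHomogeneous (V := V.comap hitClass) (fun c hc => ?_) hw
  rw [Submodule.mem_comap]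
  by_cases h : ∀ b < d, weight c b = l
  · obtain ⟨L, c', hL, hc', hcL⟩ := exists_monomial_eq_upKamekoWord hc h
    have hDL := hword L (monomial c' 1) hL
    rw [homogeneousComponent_monomial, if_pos hc', ← hcL] at hDL
    rw [← hDL]
    refine hword.mem hzero hone hd hV ((List.toFinset_nonempty_iff L).2 ?_) _
    exact List.ne_nil_of_length_pos (hL ▸ hl.trans_le hd)
  · push Not at h
    obtain ⟨b, hb, hne⟩ := h
    rw [hitClass_eq_zero.2 (monomial_mem_hit_of_weight_ne hμ le_rfl hb hc hne)]
    exact zero_mem V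

end Spanning

section Indices

variable {l : ℕ}

theorem Idx.supp_injective :
    Function.Injective (Idx.supp : Idx (l + 1) → Finset (Fin (l + 1))) := by
  intro p q h
  have hI (p : Idx (l + 1)) : p.I = p.supp.erase p.i := (Finset.erase_insert p.i_notMem_I).symm
  have hi : p.i = q.i := le_antisymm
    (Idx.i_le_of_mem_supp (h ▸ Finset.mem_insert_self q.i q.I))
    (Idx.i_le_of_mem_supp (h ▸ Finset.mem_insert_self p.i p.I))
  exact Idx.ext hi (by rw [hI p, hI q, h, hi])

instance : DecidableEq (Idx (l + 1)) := Idx.supp_injective.decidableEq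

noncomputable instance : Fintype (Idx (l + 1)) := Fintype.ofInjective _ Idx.supp_injective

theorem card_idx : Nat.card (Idx (l + 1)) = 2 ^ (l + 1) - 1 := by
  have hbij : Function.Bijective fun p : Idx (l + 1) =>
      (⟨p.supp, Finset.insert_ne_empty _ _⟩ : {T : Finset (Fin (l + 1)) // T ≠ ∅}) := by
    refine ⟨fun p q h => Idx.supp_injective (congrArg Subtype.val h), fun T => ?_⟩
    obtain ⟨p, hp⟩ := exists_supp_eq (Finset.nonempty_iff_ne_empty.2 T.2)
    exact ⟨p, Subtype.ext hp⟩
  rw [Nat.card_congr (Equiv.ofBijective _ hbij), Nat.card_eq_fintype_card,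
    Fintype.card_subtype_compl]
  simp

end Indices

section Evaluation

variable {l m d : ℕ}

/-- `(QP_k)_n`, the space of the classes modulo hit polynomials of the homogeneous polynomials of
degree `n`. -/
noncomputable def homogeneousClasses (k n : ℕ) : Submodule (ZMod 2) (P k ⧸ hit k) :=
  (homogeneousSubmodule (Fin k) (ZMod 2) n).map hitClass

theorem hitClass_mem_homogeneousClasses {k n : ℕ} {w : P k} (hw : w.IsHomogeneous n) :
    hitClass w ∈ homogeneousClasses k n :=
  Submodule.mem_map_of_mem hw

/-- The map from `QP_{l+1}` to the product of copies of `QP_l` given by all the substitutions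
`proj p`. -/
noncomputable def evalMap (l : ℕ) :
    P (l + 1) ⧸ hit (l + 1) →ₗ[ZMod 2] (Idx (l + 1) → P l ⧸ hit l) :=
  (hit (l + 1)).liftQ (LinearMap.pi fun p => hitClass ∘ₗ (proj p).toLinearMap) fun _ hw =>
    LinearMap.mem_ker.2 (funext fun p =>
      hitClass_eq_zero.2 ((isLinearSubst_proj p).map_mem_hit hw))

theorem evalMap_upKamekoWord (hμ : l ≤ mu (2 * m + l)) (L : List (Fin (l + 1))) {w : P (l + 1)}
    (hw : w.IsHomogeneous m) (p : Idx (l + 1)) : evalMap l (hitClass (upKamekoWord L w)) p =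
      if L.toFinset ⊆ p.supp then hitClass (upKamekoIter l L.length (proj p w)) else 0 :=
  hitClass_proj_upKamekoWord hμ p L hw

theorem proj_sum_supp (p : Idx (l + 1)) : proj p (∑ j ∈ p.supp, X j) = 0 := by
  have hI : proj p (∑ j ∈ p.I, X j) = proj p (X p.i) := by rw [← f_proj_X_self, proj_f]
  rw [Idx.supp, Finset.sum_insert p.i_notMem_I, map_add, hI, CharTwo.add_self_eq_zero]

theorem evalMap_upKamekoWord_sum_mul (hμ : l ≤ mu (2 * (m + 1) + l)) {p : Idx (l + 1)}
    (hp : p.supp = Finset.univ) {s : Fin l} {L : List (Fin (l + 1))}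
    (hL : L.toFinset = Finset.univ.erase (p.i.succAbove s)) {w : P l} (hw : w.IsHomogeneous m) :
    evalMap l (hitClass (upKamekoWord L ((∑ j ∈ L.toFinset, X j) * f p.i w))) =
      Pi.single p (hitClass (upKamekoIter l L.length (X s * w))) := by
  have hz : ((∑ j ∈ L.toFinset, X j) * f p.i w : P (l + 1)).IsHomogeneous (m + 1) :=
    add_comm 1 m ▸ (IsHomogeneous.sum _ _ 1 fun j _ => isHomogeneous_X (ZMod 2) j).mul
      ((isLinearSubst_f p.i).isHomogeneous_map hw)
  ext1 p'
  rw [evalMap_upKamekoWord hμ L hz]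
  rcases eq_or_ne p' p with rfl | hp'
  · have hsum : proj p' (∑ j ∈ L.toFinset, X j) = X s := by
      have h := proj_sum_supp p'
      rw [hp, ← Finset.sum_erase_add _ _ (Finset.mem_univ (p'.i.succAbove s)), ← hL, map_add,
        proj_X_succAbove, add_eq_zero_iff_eq_neg, ZModModule.neg_eq_self] at h
      exact h
    rw [Pi.single_eq_same, hp, if_pos (Finset.subset_univ _), map_mul, proj_f, hsum]
  · rw [Pi.single_eq_of_ne hp']
    split_ifs with h
    · have hsupp : L.toFinset = p'.supp := by
        have hne : p'.supp ≠ Finset.univ := fun h => hp' (Idx.supp_injective (h.trans hp.symm))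
        refine Finset.eq_of_subset_of_card_le h ((card_le_of_ne_univ hne).trans_eq ?_)
        rw [hL, card_univ_erase]
      rw [hsupp, map_mul, proj_sum_supp, zero_mul, map_zero, map_zero]
    · rfl

theorem evalMap_upKamekoWord_mem {L : List (Fin (l + 1))} (hL : L.length = d) {w : P (l + 1)}
    (hw : w.IsHomogeneous m) : evalMap l (hitClass (upKamekoWord L w)) ∈
      (homogeneousClasses (l + 1) (kamekoDegree l m d)).map (evalMap l) := by
  have h := upKamekoWord_isHomogeneous (e := 0) L hw
  rw [zero_add, hL] at h
  exact Submodule.mem_map_of_mem (hitClass_mem_homogeneousClasses h)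

theorem single_mem_map_evalMap_of_supp_eq_univ (hμ : l ≤ mu (2 * m + l)) (hm : 0 < m)
    (hd : l ≤ d) {p : Idx (l + 1)} (hp : p.supp = Finset.univ) {y : P l}
    (hy : y.IsHomogeneous m) : Pi.single p (hitClass (upKamekoIter l d y)) ∈
      (homogeneousClasses (l + 1) (kamekoDegree l m d)).map (evalMap l) := by
  obtain ⟨m, rfl⟩ := Nat.exists_eq_succ_of_ne_zero hm.ne'
  set H := (homogeneousClasses (l + 1) (kamekoDegree l (m + 1) d)).map (evalMap l)
  refine mem_of_isHomogeneous (V := H.comap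
    (LinearMap.single (ZMod 2) _ p ∘ₗ hitClass ∘ₗ upKamekoIter l d)) (fun b hb => ?_) hy
  obtain ⟨s, hs⟩ : ∃ s, b s ≠ 0 := by
    by_contra! h
    rw [Finsupp.ext (g := 0) h, map_zero] at hb
    exact hm.ne hb
  obtain ⟨b, rfl⟩ := exists_add_of_le (Finsupp.single_le_iff.2 (Nat.one_le_iff_ne_zero.2 hs))
  have hw : (monomial b 1 : P l).IsHomogeneous m := isHomogeneous_monomial _ (by
    rw [map_add, Finsupp.degree_single] at hb
    omega)
  have hcard : (Finset.univ.erase (p.i.succAbove s)).card = l := card_univ_erase _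
  obtain ⟨L, rfl, hLs⟩ := exists_toFinset_eq (Finset.card_pos.1 (s.pos.trans_eq hcard.symm))
    (hcard.trans_le hd)
  have h := evalMap_upKamekoWord_sum_mul hμ hp hLs hw
  rw [Submodule.mem_comap, monomial_single_add, pow_one, LinearMap.comp_apply, LinearMap.comp_apply,
    LinearMap.coe_single, ← h]
  exact evalMap_upKamekoWord_mem rfl (add_comm 1 m ▸
    (IsHomogeneous.sum _ _ 1 fun j _ => isHomogeneous_X (ZMod 2) j).mul
      ((isLinearSubst_f p.i).isHomogeneous_map hw))

/-- If `L` is a word with set of letters `p.supp`, the coordinates of the value on the image of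
`f p.i y` under `L` vanish outside the `q` with `p.supp ⊆ q.supp`: the system is triangular. -/
theorem single_mem_map_evalMap (hμ : l ≤ mu (2 * m + l)) (hm : 0 < m) (hd : l ≤ d)
    (p : Idx (l + 1)) {y : P l} (hy : y.IsHomogeneous m) :
    Pi.single p (hitClass (upKamekoIter l d y)) ∈
      (homogeneousClasses (l + 1) (kamekoDegree l m d)).map (evalMap l) := by
  induction hT : p.supp using WellFoundedGT.induction generalizing p y with
  | _ T ih =>
  subst hT
  by_cases hp : p.supp = Finset.univ
  · exact single_mem_map_evalMap_of_supp_eq_univ hμ hm hd hp hy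
  obtain ⟨L, hL, hLp⟩ :=
    exists_toFinset_eq (S := p.supp) (Finset.insert_nonempty p.i p.I)
      ((card_le_of_ne_univ hp).trans hd)
  have hfy := (isLinearSubst_f p.i).isHomogeneous_map hy
  have hval (q : Idx (l + 1)) := evalMap_upKamekoWord hμ L hfy q
  have hsum := Finset.univ_sum_single (evalMap l (hitClass (upKamekoWord L (f p.i y))))
  rw [← Finset.add_sum_erase _ _ (Finset.mem_univ p), hval, hLp, hL, if_pos (subset_refl _),
    proj_f, ← eq_sub_iff_add_eq] at hsum
  rw [hsum]
  refine sub_mem (evalMap_upKamekoWord_mem hL hfy) (sum_mem fun q hq => ?_)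
  rw [hval, hLp, hL]
  split_ifs with h
  · refine ih _ (h.ssubset_of_ne fun h' => ?_) q
      ((isLinearSubst_proj q).isHomogeneous_map hfy) rfl
    exact Finset.ne_of_mem_erase hq (Idx.supp_injective h').symm
  · rw [Pi.single_zero]
    exact zero_mem _

end Evaluation

section GeneratingSets

variable {k n : ℕ} {S : Set (P k)}

theorem isGeneratingSet_iff : IsGeneratingSet k n S ↔
    S ⊆ homogeneousSubmodule (Fin k) (ZMod 2) n ∧
      homogeneousClasses k n ≤ Submodule.span (ZMod 2) (hitClass '' S) := by
  rw [IsGeneratingSet, homogeneousClasses, ← Submodule.map_span, Submodule.map_le_iff_le_comap,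
    Submodule.comap_map_eq, Submodule.ker_mkQ]

theorem isMinimalGeneratingSet_iff : IsMinimalGeneratingSet k n S ↔
    IsGeneratingSet k n S ∧ LinearIndepOn (ZMod 2) hitClass S := by
  rw [linearIndepOn_iff_notMem_span]
  refine ⟨fun hS => ⟨hS.prop, fun s hs hspan => ?_⟩,
    fun ⟨hS, hli⟩ => ⟨hS, fun T hT hTS s hs => ?_⟩⟩
  · obtain ⟨hSn, hSspan⟩ := isGeneratingSet_iff.1 hS.prop
    have hgen : IsGeneratingSet k n (S \ {s}) := by
      refine isGeneratingSet_iff.2 ⟨Set.sdiff_subset.trans hSn, hSspan.trans ?_⟩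
      rw [Submodule.span_le]
      rintro _ ⟨t, ht, rfl⟩
      rcases eq_or_ne t s with rfl | hts
      · exact hspan
      · exact Submodule.subset_span ⟨t, ⟨ht, hts⟩, rfl⟩
    exact (hS.le_of_le hgen Set.sdiff_subset hs).2 rfl
  · by_contra hsT
    refine hli s hs (Submodule.span_mono (Set.image_mono ?_)
      ((isGeneratingSet_iff.1 hT).2 (hitClass_mem_homogeneousClasses (hS.1 hs))))
    exact Set.subset_sdiff_singleton hTS hsT

theorem finite_of_linearIndepOn (hS : S ⊆ homogeneousSubmodule (Fin k) (ZMod 2) n)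
    (hli : LinearIndepOn (ZMod 2) hitClass S) : Finite S := by
  have : Module.Finite (ZMod 2) (homogeneousClasses k n) :=
    Module.Finite.iff_fg.2 ((homogeneousSubmodule_fg _ _ n).map hitClass)
  let v : S → homogeneousClasses k n := fun s =>
    ⟨hitClass s.1, hitClass_mem_homogeneousClasses (hS s.2)⟩
  have hv : LinearIndependent (ZMod 2) v :=
    LinearIndependent.of_comp (homogeneousClasses k n).subtype hli
  exact hv.finite

theorem exists_span_sub_mem_hit (hS : IsGeneratingSet k n S) {w : P k} (hw : w.IsHomogeneous n) :
    ∃ s ∈ Submodule.span (ZMod 2) S, w - s ∈ hit k ∧ (w - s).IsHomogeneous n := by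
  obtain ⟨s, hs, h, hh, rfl⟩ := Submodule.mem_sup.1 (hS.2 hw)
  exact ⟨s, hs, by rwa [add_sub_cancel_left],
    sub_mem hw (Submodule.span_le.2 hS.1 hs)⟩

end GeneratingSets

section PhiBasis

variable {l m d : ℕ} {B : Set (P l)}

theorem hitClass_phi_mem_span (hμ : l ≤ mu (2 * m + l)) (hm : 0 < m) (hd : l ≤ d)
    (hB : IsGeneratingSet l (kamekoDegree l m d) B) (p : Idx (l + 1)) {y : P l}
    (hy : y.IsHomogeneous (kamekoDegree l m d)) :
    hitClass (phi p y) ∈ Submodule.span (ZMod 2) ((fun b => hitClass (phi p b)) '' B) := by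
  obtain ⟨s, hs, hsub, hdeg⟩ := exists_span_sub_mem_hit hB hy
  have h : hitClass (phi p y) = hitClass (phi p s) := by
    rw [hitClass_eq_hitClass, ← map_sub]
    exact phi_mem_hit hμ hm hd p hsub hdeg
  rw [h]
  exact Submodule.image_span_subset_span (hitClass ∘ₗ phi p) B ⟨s, hs, rfl⟩

theorem homogeneousClasses_le_span_phi (hl : 0 < l) (hμ : l ≤ mu (2 * m + l)) (hm : 0 < m)
    (hd : l ≤ d) (hB : IsGeneratingSet l (kamekoDegree l m d) B) :
    homogeneousClasses (l + 1) (kamekoDegree l m d) ≤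
      Submodule.span (ZMod 2)
        (Set.range fun x : Σ _ : Idx (l + 1), B => hitClass (phi x.1 x.2.1)) := by
  rintro _ ⟨w, hw, rfl⟩
  refine hitClass_mem_of_forall_phi_mem hl hμ hm hd (fun p y hy => ?_) hw
  refine Submodule.span_mono ?_
    (hitClass_phi_mem_span hμ hm hd hB p (upKamekoIter_isHomogeneous d hy))
  rintro _ ⟨b, hb, rfl⟩
  exact ⟨⟨p, b, hb⟩, rfl⟩

/-- The images under `evalMap` span a space which contains the independent family of the vectors
`Pi.single p (hitClass b)`, of the same finite size. -/
theorem linearIndependent_hitClass_phi (hl : 0 < l) (hμ : l ≤ mu (2 * m + l)) (hm : 0 < m)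
    (hd : l ≤ d) (hB : IsMinimalGeneratingSet l (kamekoDegree l m d) B) :
    LinearIndependent (ZMod 2)
      fun x : Σ _ : Idx (l + 1), B => hitClass (phi x.1 x.2.1) := by
  obtain ⟨hgen, hli⟩ := isMinimalGeneratingSet_iff.1 hB
  have : Finite B := finite_of_linearIndepOn hgen.1 hli
  have := Fintype.ofFinite B
  have hsingle := Pi.linearIndependent_single (η := Idx (l + 1))
    (fun _ (b : B) => hitClass b.1) fun _ => hli
  refine LinearIndependent.of_comp (evalMap l) ?_
  rw [linearIndependent_iff_card_le_finrank_span, ← finrank_span_eq_card hsingle]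
  have := FiniteDimensional.span_of_finite (ZMod 2) (Set.finite_range
    (evalMap l ∘ fun x : Σ _ : Idx (l + 1), B => hitClass (phi x.1 x.2.1)))
  refine Submodule.finrank_mono (Submodule.span_le.2 ?_)
  rintro _ ⟨⟨p, b⟩, rfl⟩
  obtain ⟨y, hy, hby⟩ := exists_upKamekoIter_sub_mem_irregular (hgen.1 b.2)
  have hb : hitClass b.1 = hitClass (upKamekoIter l d y) :=
    hitClass_eq_hitClass.2 (irregular_le_hit hμ d hby)
  have hmem := Submodule.map_mono (f := evalMap l)
    (homogeneousClasses_le_span_phi hl hμ hm hd hgen) (single_mem_map_evalMap hμ hm hd p hy)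
  rwa [Submodule.map_span, ← Set.range_comp, ← hb] at hmem

theorem PZero_le_comap_span_phi (hμ : l ≤ mu (2 * m + l)) (hm : 0 < m) (hd : l ≤ d)
    (hB : IsGeneratingSet l (kamekoDegree l m d) B) :
    PZero (l + 1) ≤ (Submodule.span (ZMod 2)
      ((fun x : Σ _ : Idx (l + 1), B => hitClass (phi x.1 x.2.1)) '' {x | x.1.I = ∅})).comap
        (hitClass ∘ₗ homogeneousComponent (kamekoDegree l m d)) := by
  refine Submodule.span_le.2 ?_
  rintro _ ⟨c, ⟨j, hj⟩, rfl⟩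
  rw [SetLike.mem_coe, Submodule.mem_comap, LinearMap.comp_apply, homogeneousComponent_monomial]
  split_ifs with hc
  · obtain ⟨c', hc', hdeg, -⟩ := exists_f_eq_monomial hj
    let q : Idx (l + 1) := ⟨j, ∅, fun _ h => absurd h (Finset.notMem_empty _)⟩
    rw [← hc', ← phi_of_empty (p := q) rfl]
    refine Submodule.span_mono ?_ (hitClass_phi_mem_span hμ hm hd hB q
      (isHomogeneous_monomial _ (hdeg.trans hc)))
    rintro _ ⟨b, hb, rfl⟩
    exact ⟨⟨q, b, hb⟩, rfl, rfl⟩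
  · rw [map_zero]
    exact zero_mem _

theorem phi_notMem_PZero (hl : 0 < l) (hμ : l ≤ mu (2 * m + l)) (hm : 0 < m) (hd : l ≤ d)
    (hB : IsMinimalGeneratingSet l (kamekoDegree l m d) B) {p : Idx (l + 1)} (hp : p.I ≠ ∅)
    {b : P l} (hb : b ∈ B) : phi p b ∉ PZero (l + 1) := by
  intro h
  have hmem := PZero_le_comap_span_phi hμ hm hd hB.prop h
  rw [Submodule.mem_comap, LinearMap.comp_apply,
    homogeneousComponent_of_mem (phi_isHomogeneous p (hB.prop.1 hb)), if_pos rfl] at hmem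
  exact (linearIndependent_hitClass_phi hl hμ hm hd hB).notMem_span_image
    (s := {x | x.1.I = ∅}) (x := ⟨p, b, hb⟩) hp hmem

theorem Phi_eq_iUnion (hB : ∀ p : Idx (l + 1), p.I ≠ ∅ → ∀ b ∈ B, phi p b ∉ PZero (l + 1)) :
    Phi B = ⋃ p : Idx (l + 1), phi p '' B := by
  refine Set.Subset.antisymm (Set.union_subset ?_ ?_) (Set.iUnion_subset fun p => ?_)
  · refine Set.iUnion_subset fun i => ?_
    let p : Idx (l + 1) := ⟨i, ∅, fun _ h => absurd h (Finset.notMem_empty _)⟩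
    rw [← Set.image_congr fun b _ => phi_of_empty (p := p) rfl b]
    exact Set.subset_iUnion (fun p : Idx (l + 1) => phi p '' B) p
  · exact Set.sdiff_subset.trans (Set.iUnion_mono fun p => Set.iUnion_subset fun _ => subset_rfl)
  · rintro _ ⟨b, hb, rfl⟩
    by_cases hp : p.I = ∅
    · exact .inl (Set.mem_iUnion.2 ⟨p.i, b, hb, (phi_of_empty hp b).symm⟩)
    · have hr : 0 < p.r := Finset.card_pos.2 (Finset.nonempty_iff_ne_empty.2 hp)
      exact .inr ⟨Set.mem_iUnion₂.2 ⟨p, hr, b, hb, rfl⟩, hB p hp b hb⟩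

theorem isMinimalGeneratingSet_iUnion_phi (hl : 0 < l) (hμ : l ≤ mu (2 * m + l)) (hm : 0 < m)
    (hd : l ≤ d) (hB : IsMinimalGeneratingSet l (kamekoDegree l m d) B) :
    IsMinimalGeneratingSet (l + 1) (kamekoDegree l m d) (⋃ p : Idx (l + 1), phi p '' B) := by
  have hli := linearIndependent_hitClass_phi hl hμ hm hd hB
  have hrange : (⋃ p : Idx (l + 1), phi p '' B) =
      Set.range fun x : Σ _ : Idx (l + 1), B => phi x.1 x.2.1 := by
    ext
    simp only [Set.mem_iUnion, Set.mem_image, Set.mem_range, Sigma.exists, Subtype.exists,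
      exists_prop]
  rw [hrange, isMinimalGeneratingSet_iff, isGeneratingSet_iff, ← Set.range_comp,
    linearIndepOn_range_iff fun _ _ h => hli.injective (congrArg hitClass h)]
  refine ⟨⟨?_, homogeneousClasses_le_span_phi hl hμ hm hd hB.prop⟩, hli⟩
  rintro _ ⟨⟨p, b⟩, rfl⟩
  exact phi_isHomogeneous p (hB.prop.1 b.2)

theorem disjoint_image_phi (hl : 0 < l) (hμ : l ≤ mu (2 * m + l)) (hm : 0 < m) (hd : l ≤ d)
    (hB : IsMinimalGeneratingSet l (kamekoDegree l m d) B) {p q : Idx (l + 1)} (hpq : p ≠ q) :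
    Disjoint (phi p '' B) (phi q '' B) := by
  have hinj := (linearIndependent_hitClass_phi hl hμ hm hd hB).injective
  refine Set.disjoint_left.2 ?_
  rintro _ ⟨b, hb, rfl⟩ ⟨c, hc, hbc⟩
  have h := @hinj ⟨q, c, hc⟩ ⟨p, b, hb⟩ (congrArg hitClass hbc)
  exact hpq (congrArg Sigma.fst h).symm

theorem injOn_phi (hl : 0 < l) (hμ : l ≤ mu (2 * m + l)) (hm : 0 < m) (hd : l ≤ d)
    (hB : IsMinimalGeneratingSet l (kamekoDegree l m d) B) (p : Idx (l + 1)) :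
    Set.InjOn (phi p) B := by
  have hinj := (linearIndependent_hitClass_phi hl hμ hm hd hB).injective
  intro b hb c hc hbc
  have h := @hinj ⟨p, b, hb⟩ ⟨p, c, hc⟩ (congrArg hitClass hbc)
  simpa only [Sigma.mk.injEq, heq_eq_eq, true_and, Subtype.mk.injEq] using h

end PhiBasis

section Exponents

variable {l : ℕ} {d : ℕ → ℕ}

theorem strictAntiOn_Icc_of_succ_lt (hdec : ∀ i, 1 ≤ i → i + 1 ≤ l - 1 → d (i + 1) < d i) :
    StrictAntiOn d (Set.Icc 1 (l - 1)) :=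
  strictAntiOn_of_succ_lt Set.ordConnected_Icc fun i _ hi hi' => hdec i hi.1 hi'.2

theorem le_of_mem_Icc (hdec : ∀ i, 1 ≤ i → i + 1 ≤ l - 1 → d (i + 1) < d i)
    (hlast : d l ≤ d (l - 1)) {i : ℕ} (hi : i ∈ Finset.Icc 1 l) : d l ≤ d i := by
  rw [Finset.mem_Icc] at hi
  rcases hi.2.lt_or_eq with h | rfl
  · have hanti := (strictAntiOn_Icc_of_succ_lt hdec).antitoneOn
    exact hlast.trans (hanti ⟨hi.1, by omega⟩ ⟨by omega, le_rfl⟩ (by omega))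
  · exact le_rfl

theorem sum_two_pow_sub_one_eq (hle : ∀ i ∈ Finset.Icc 1 l, d l ≤ d i) :
    ∑ i ∈ Finset.Icc 1 l, (2 ^ d i - 1) =
      2 ^ d l * ∑ i ∈ Finset.Icc 1 l, (2 ^ (d i - d l) - 1) + l * (2 ^ d l - 1) := by
  have hterm (i : ℕ) (hi : i ∈ Finset.Icc 1 l) :
      2 ^ d i - 1 = 2 ^ d l * (2 ^ (d i - d l) - 1) + (2 ^ d l - 1) := by
    have hpow : 2 ^ d i = 2 ^ d l * 2 ^ (d i - d l) := by
      rw [← pow_add, Nat.add_sub_cancel' (hle i hi)]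
    have := Nat.one_le_two_pow (n := d l)
    have := Nat.le_mul_of_pos_right (2 ^ d l) (Nat.two_pow_pos (d i - d l))
    rw [hpow, Nat.mul_sub_one]
    omega
  rw [Finset.sum_congr rfl hterm, Finset.sum_add_distrib, ← Finset.mul_sum, Finset.sum_const,
    Nat.card_Icc, Nat.add_sub_cancel, smul_eq_mul]

theorem le_mu_of_exponents (hl : 0 < l)
    (hdec : ∀ i, 1 ≤ i → i + 1 ≤ l - 1 → d (i + 1) < d i) (hlast : d l ≤ d (l - 1)) :
    l ≤ mu (2 * ∑ i ∈ Finset.Icc 1 l, (2 ^ (d i - d l) - 1) + l) := by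
  obtain ⟨l, rfl⟩ : ∃ l', l = l' + 1 := ⟨l - 1, by omega⟩
  have hanti : StrictAntiOn d (Set.Icc 1 l) := strictAntiOn_Icc_of_succ_lt hdec
  set e : ℕ → ℕ := fun i => d i - d (l + 1) + 1
  have hinj : Set.InjOn e (Finset.Icc 1 l) := fun i hi j hj hij => by
    have hi' := le_of_mem_Icc hdec hlast (Finset.Icc_subset_Icc_right l.le_succ hi)
    have hj' := le_of_mem_Icc hdec hlast (Finset.Icc_subset_Icc_right l.le_succ hj)
    rw [Finset.coe_Icc] at hi hj
    exact hanti.injOn hi hj (by simp only [e] at hij; omega)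
  have hcard : ((Finset.Icc 1 l).image e).card = l := by
    rw [Finset.card_image_of_injOn hinj, Nat.card_Icc, Nat.add_sub_cancel]
  have hsum : ∑ i ∈ (Finset.Icc 1 l).image e, (2 ^ i - 1) + (2 ^ 1 - 1) =
      2 * ∑ i ∈ Finset.Icc 1 (l + 1), (2 ^ (d i - d (l + 1)) - 1) + (l + 1) := by
    simp only [Finset.sum_image hinj, e, two_pow_succ_sub_one]
    rw [Finset.sum_Icc_succ_top (by omega), Finset.sum_add_distrib, ← Finset.mul_sum]
    simp only [Finset.sum_const, Nat.card_Icc, Nat.add_sub_cancel, smul_eq_mul, mul_one, pow_zero,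
      tsub_self, mul_zero, zero_add, add_zero]
    omega
  have hlt := card_lt_mu (S := (Finset.Icc 1 l).image e) le_rfl fun i hi => by
    obtain ⟨j, -, rfl⟩ := Finset.mem_image.1 hi
    exact Nat.succ_pos _
  rwa [hcard, hsum] at hlt

theorem sum_pos_of_exponents (hl : 3 ≤ l)
    (hdec : ∀ i, 1 ≤ i → i + 1 ≤ l - 1 → d (i + 1) < d i) (hlast : d l ≤ d (l - 1)) :
    0 < ∑ i ∈ Finset.Icc 1 l, (2 ^ (d i - d l) - 1) := by
  refine Finset.sum_pos' (fun _ _ => Nat.zero_le _) ⟨1, Finset.mem_Icc.2 ⟨le_rfl, by omega⟩, ?_⟩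
  have h₂ := le_of_mem_Icc hdec hlast (Finset.mem_Icc.2 ⟨one_le_two, by omega⟩)
  have h₁ : d 2 < d 1 := hdec 1 le_rfl (by omega)
  exact Nat.sub_pos_of_lt (Nat.one_lt_two_pow (by omega))

end Exponents

end HitProblem

theorem proposition3p1_general {l m d n : ℕ} (hl : 0 < l) (hμ : l ≤ mu (2 * m + l)) (hm : 0 < m)
    (hd : l ≤ d) (hn : n = 2 ^ d * m + l * (2 ^ d - 1)) {B : Set (P l)}
    (hB : IsMinimalGeneratingSet l n B) :
    IsMinimalGeneratingSet (l + 1) n (Phi B) ∧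
      Phi B = ⋃ p : Idx (l + 1), phi p '' B ∧
      (∀ p q : Idx (l + 1), p ≠ q → Disjoint (phi p '' B) (phi q '' B)) ∧
      (∀ p : Idx (l + 1), (phi p '' B).encard = B.encard) ∧
      Nat.card (Idx (l + 1)) = 2 ^ (l + 1) - 1 := by
  obtain rfl : n = kamekoDegree l m d := hn.trans (kamekoDegree_eq l m d).symm
  have hPhi : Phi B = ⋃ p : Idx (l + 1), phi p '' B :=
    Phi_eq_iUnion fun _ hp _ hb => phi_notMem_PZero hl hμ hm hd hB hp hb
  exact ⟨hPhi ▸ isMinimalGeneratingSet_iUnion_phi hl hμ hm hd hB, hPhi,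
    fun _ _ => disjoint_image_phi hl hμ hm hd hB,
    fun p => (injOn_phi hl hμ hm hd hB p).encard_image, card_idx⟩

theorem proposition3p1 (l : ℕ) (hl : 3 ≤ l) (d : ℕ → ℕ)
    (hdec : ∀ i, 1 ≤ i → i + 1 ≤ l - 1 → d (i + 1) < d i)
    (hlast : d l ≤ d (l - 1)) (hmin : l ≤ d l)
    (n : ℕ) (hn : n = ∑ i ∈ Finset.Icc 1 l, (2 ^ d i - 1))
    (B : Set (P l)) (hB : IsMinimalGeneratingSet l n B) :
    IsMinimalGeneratingSet (l + 1) n (Phi B) ∧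
      Phi B = ⋃ p : Idx (l + 1), phi p '' B ∧
      (∀ p q : Idx (l + 1), p ≠ q → Disjoint (phi p '' B) (phi q '' B)) ∧
      (∀ p : Idx (l + 1), (phi p '' B).encard = B.encard) ∧
      Nat.card (Idx (l + 1)) = 2 ^ (l + 1) - 1 :=
  proposition3p1_general (by omega) (le_mu_of_exponents (by omega) hdec hlast)
    (sum_pos_of_exponents hl hdec hlast) hmin
    (hn.trans (sum_two_pow_sub_one_eq fun _ => le_of_mem_Icc hdec hlast)) hB
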